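/- Let $(M,g,J,\omega)$ be an almost Hermitian $4$-manifold: $M$ is a smooth $4$-manifold, $g$ a smooth Riemannian metric, $J$ a smooth $g$-orthogonal almost complex structure, $\omega(X,Y)=g(JX,Y)$. Let $\nabla$ be the Levi-Civita connection, $R_{X,Y}=\nabla_{[X,Y]}-[\nabla_X,\nabla_Y]$, $R_{XYZW}=g(R_{X,Y}Z,W)$, let $\mathrm{Ric}$ be the Ricci tensor (positive on round spheres), $s$ its trace, $\mathrm{Ric}_0=\mathrm{Ric}-\frac s4 g$, viewed also as an endomorphism of vectors and, by duality, of $1$-forms. On $1$-forms $(J\alpha)(X)=-\alpha(JX)$; $\theta=J\delta\omega$ is the Lee form (equivalently $d\omega=\theta\wedge\omega$). $N(A,B)=[JA,JB]-[A,B]-J[JA,B]-J[A,JB]$ is the Nijenhuis tensor, $\mathrm{Im}\,N\subset TM$ the span of its values at each point, and $|N|^2=\frac12\sum_{i,j}|N(e_i,e_j)|^2$ in an orthonormal basis; $2$-forms carry the scalar product with $|e^1\wedge e^2|=1$. Put $\rho(X,Y)=\mathrm{Ric}'(JX,Y)$ with $\mathrm{Ric}'$ the $J$-invariant part of $\mathrm{Ric}$;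 $\rho^*=R(\omega)$, i.e. $\rho^*(X,Y)=\frac12\sum_i g(R_{X,Y}e_i,Je_i)$; and $\Phi(X,Y)=\frac12\langle J(\nabla_X\omega),\nabla_Y\omega\rangle$, where $(J\psi)(A,B)=-\psi(JA,B)$ for a $J$-anti-invariant $2$-form $\psi$. Let $\omega|_{\mathrm{Im}\,N}$ be the restriction of $\omega$ to $\mathrm{Im}\,N$, extended by zero on the orthogonal complement. Suppose that $(M,g,J,\omega)$ is of class $\mathcal{AH}_1$, that is, $R_{XYZW}=R_{XYJZJW}$ for all $X,Y,Z,W$. Then: (a) $\mathrm{Ric}_0(\theta)=-\frac s4\theta$ and $\mathrm{Ric}_0(J\theta)=-\frac s4 J\theta$. (b) At all points where $s\neq 0$, $\mathrm{Span}(\theta,J\theta)$ (identified with a space of vectors by the metric) and $\mathrm{Im}\,N$ are orthogonal. (c) $\mathrm{Ric}_0(X)=\frac s4X$ for every $X\in\mathrm{Im}\,N$ (at every point). (d) At each point where $s=0$, either $\mathrm{Ric}=0$, or both $\theta=0$ and $N=0$. (e) $d\rho=0$ and $d\Phi=0$ on $M$, and at each point $\rho$ and $\Phi$ are collinear or one of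 them is zero (that is, they are linearly dependent). At points where $s\neq0$, $\theta\neq0$ and $N\neq0$, $$\rho=\frac s2\,\omega|_{\mathrm{Im}\,N},\qquad \Phi=\frac14\Big(|\theta|^2-\frac14|N|^2\Big)\,\omega|_{\mathrm{Im}\,N}=-\frac12(\delta\theta)\,\omega|_{\mathrm{Im}\,N}.$$ (f) $\rho^*\wedge\Phi=0$ at every point of $M$. -/

import Mathlib

open scoped Manifold ContDiff
open Bundle

noncomputable section

/-- The model space of a 4-manifold. -/
abbrev R4 : Type := EuclideanSpace ℝ (Fin 4)

/-! ### Almost Hermitian 4-manifolds -/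

/-- An almost Hermitian structure on a smooth 4-manifold: a smooth Riemannian metric `g` and a
smooth `g`-orthogonal almost complex structure `J`. -/
structure AlmostHermitian (M : Type*) [TopologicalSpace M] [ChartedSpace R4 M]
    [IsManifold (𝓡 4) ∞ M] where
  /-- the Riemannian metric -/
  g : ContMDiffRiemannianMetric (𝓡 4) ∞ R4 (fun p : M ↦ TangentSpace (𝓡 4) p)
  /-- the almost complex structure -/
  J : ∀ p : M, TangentSpace (𝓡 4) p →L[ℝ] TangentSpace (𝓡 4) p
  smooth_J : ContMDiff (𝓡 4) ((𝓡 4).prod 𝓘(ℝ, R4 →L[ℝ] R4)) ∞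
    (fun p ↦ TotalSpace.mk' (R4 →L[ℝ] R4)
      (E := fun p : M ↦ TangentSpace (𝓡 4) p →L[ℝ] TangentSpace (𝓡 4) p) p (J p))
  J_sq : ∀ (p : M) (v : TangentSpace (𝓡 4) p), J p (J p v) = -v
  J_orth : ∀ (p : M) (v w : TangentSpace (𝓡 4) p), g.inner p (J p v) (J p w) = g.inner p v w

/-- The expression in a chart of a metric and an almost complex structure: at a point `x` of the
chart's target, `g x` is a scalar product and `J x` an endomorphism of the space `R4` of
coordinate vectors. -/
structure Coord where
  /-- the metric in coordinates -/
  g : R4 → R4 → R4 → ℝ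
  /-- the almost complex structure in coordinates -/
  J : R4 → R4 → R4

/-- The expression of an almost Hermitian structure in the chart `e`: `g` is pulled back by the
inverse chart, and `J` is conjugated by the differential of the chart. -/
def AlmostHermitian.inChart {M : Type*} [TopologicalSpace M] [ChartedSpace R4 M]
    [IsManifold (𝓡 4) ∞ M] (A : AlmostHermitian M) (e : OpenPartialHomeomorph M R4) : Coord where
  g x u v := A.g.inner (e.symm x) (mfderiv (𝓡 4) (𝓡 4) e.symm x u)
    (mfderiv (𝓡 4) (𝓡 4) e.symm x v)
  J x u := mfderiv (𝓡 4) (𝓡 4) e (e.symm x)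
    (A.J (e.symm x) (mfderiv (𝓡 4) (𝓡 4) e.symm x u))

namespace Coord

/-! ### Tensor calculus in a chart

In what follows `x` is a point of the target of the chart, and `u v w z : R4` are coordinate
vectors at `x`, extended to constant coordinate vector fields wherever they are differentiated. -/

/-- The coordinate vector fields. -/
def basisVec (i : Fin 4) : R4 := EuclideanSpace.single i 1

/-- The directional derivative `∂_u f` at `x`. -/
def pd {F : Type*} [NormedAddCommGroup F] [NormedSpace ℝ F] (u : R4) (f : R4 → F) (x : R4) : F :=
  fderiv ℝ f x u

variable (c : Coord) (x : R4)

/-- The inverse metric `g^{ij}`. -/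
def ginv (i j : Fin 4) : ℝ :=
  (Matrix.of fun k l ↦ c.g x (basisVec k) (basisVec l))⁻¹ i j

/-- The metric trace `g^{ij} T(e_i, e_j)` of a bilinear form. -/
def tr (T : R4 → R4 → ℝ) : ℝ := ∑ i, ∑ j, c.ginv x i j * T (basisVec i) (basisVec j)

/-- The vector `α♯` dual to the 1-form `α`. -/
def sharp (α : R4 → ℝ) : R4 := ∑ i, ∑ j, (c.ginv x i j * α (basisVec i)) • basisVec j

/-- The scalar product of 1-forms. -/
def inner1 (α β : R4 → ℝ) : ℝ := c.tr x fun u v ↦ α u * β v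

/-- The scalar product of 2-forms `½ g^{ia} g^{jb} α_{ij} β_{ab}`,
normalized so that `|e¹ ∧ e²| = 1`. -/
def inner2 (α β : R4 → R4 → ℝ) : ℝ :=
  (1 / 2) * c.tr x fun u u' ↦ c.tr x fun v v' ↦ α u v * β u' v'

/-- The Christoffel symbols: `Γ(u, v) = ∇_u v` for constant coordinate fields. -/
def christoffel (u v : R4) : R4 :=
  c.sharp x fun w ↦ (1 / 2) * (pd u (fun y ↦ c.g y v w) x + pd v (fun y ↦ c.g y u w) x
    - pd w (fun y ↦ c.g y u v) x)

/-- The Levi-Civita derivative `(∇_u α)(v)` of a 1-form. -/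
def nabla1 (α : R4 → R4 → ℝ) (u v : R4) : ℝ :=
  pd u (fun y ↦ α y v) x - α x (c.christoffel x u v)

/-- The Levi-Civita derivative `(∇_u β)(v, w)` of a 2-form. -/
def nabla2 (β : R4 → R4 → R4 → ℝ) (u v w : R4) : ℝ :=
  pd u (fun y ↦ β y v w) x - β x (c.christoffel x u v) w - β x v (c.christoffel x u w)

/-- The codifferential of a 1-form, `δα = -∑ (∇_{e_i} α)(e_i)`. -/
def delta1 (α : R4 → R4 → ℝ) : ℝ := -c.tr x (c.nabla1 x α)

/-- The codifferential of a 2-form, `(δβ)(v) = -∑ (∇_{e_i} β)(e_i, v)`. -/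
def delta2 (β : R4 → R4 → R4 → ℝ) (v : R4) : ℝ :=
  -c.tr x fun u u' ↦ c.nabla2 x β u u' v

/-- The exterior derivative of a 2-form. -/
def extd (β : R4 → R4 → R4 → ℝ) (x u v w : R4) : ℝ :=
  pd u (fun y ↦ β y v w) x - pd v (fun y ↦ β y u w) x + pd w (fun y ↦ β y u v) x

/-- The wedge product of two 2-forms at a point. -/
def wedge (α β : R4 → R4 → ℝ) (u v w z : R4) : ℝ :=
  α u v * β w z - α u w * β v z + α u z * β v w
    + α v w * β u z - α v z * β u w + α w z * β u v

/-! ### Curvature -/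

/-- The curvature operator `R_{u,v} w`, with the sign `R_{X,Y} = ∇_{[X,Y]} - [∇_X, ∇_Y]`. -/
def curvOp (u v w : R4) : R4 :=
  -(pd u (fun y ↦ c.christoffel y v w) x + c.christoffel x u (c.christoffel x v w)
    - pd v (fun y ↦ c.christoffel y u w) x - c.christoffel x v (c.christoffel x u w))

/-- The curvature tensor `R_{uvwz} = g(R_{u,v} w, z)`; `R_{uvuv} > 0` on round spheres. -/
def curv (u v w z : R4) : ℝ := c.g x (c.curvOp x u v w) z

/-- The Ricci tensor (positive on round spheres). -/
def ricci (u v : R4) : ℝ := c.tr x fun w z ↦ c.curv x u w v z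

/-- The scalar curvature `s`. -/
def scal : ℝ := c.tr x (c.ricci x)

/-- The trace-free part `Ric₀ = Ric - (s/4) g` of the Ricci tensor. -/
def ricci0 (u v : R4) : ℝ := c.ricci x u v - c.scal x / 4 * c.g x u v

/-- `Ric₀` as an endomorphism of the tangent space. -/
def ricci0Vec (u : R4) : R4 := c.sharp x (c.ricci0 x u)

/-- `Ric₀` as an endomorphism of the space of 1-forms. -/
def ricci0Form (α : R4 → ℝ) (v : R4) : ℝ := c.ricci0 x (c.sharp x α) v

/-! ### The almost complex structure -/

/-- The action of `J` on 1-forms, `(Jα)(u) = -α(Ju)`. -/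
def Jform (α : R4 → ℝ) (u : R4) : ℝ := -α (c.J x u)

/-- The fundamental form `ω(u, v) = g(Ju, v)`. -/
def omega (u v : R4) : ℝ := c.g x (c.J x u) v

/-- The Lee form `θ = Jδω`. -/
def lee : R4 → ℝ := c.Jform x (c.delta2 x c.omega)

/-- The Nijenhuis tensor `N(u, v) = [Ju, Jv] - [u, v] - J[Ju, v] - J[u, Jv]`. -/
def nij (u v : R4) : R4 :=
  VectorField.lieBracket ℝ (fun y ↦ c.J y u) (fun y ↦ c.J y v) x
    - VectorField.lieBracket ℝ (fun _ ↦ u) (fun _ ↦ v) x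
    - c.J x (VectorField.lieBracket ℝ (fun y ↦ c.J y u) (fun _ ↦ v) x)
    - c.J x (VectorField.lieBracket ℝ (fun _ ↦ u) (fun y ↦ c.J y v) x)

/-- The image of the Nijenhuis tensor, a subspace of the tangent space. -/
def imN : Submodule ℝ R4 := Submodule.span ℝ {n | ∃ u v, n = c.nij x u v}

/-- `|N|²`, where `N` is viewed as a 2-form with values in the tangent space. -/
def nijNormSq : ℝ :=
  (1 / 2) * c.tr x fun u u' ↦ c.tr x fun v v' ↦ c.g x (c.nij x u v) (c.nij x u' v')

/-- The `g`-orthogonal projection of `u` onto the subspace `W`. -/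
def proj (W : Submodule ℝ R4) (u : R4) : R4 :=
  Classical.epsilon fun a ↦ a ∈ W ∧ ∀ w ∈ W, c.g x (u - a) w = 0

/-- The 2-form `ω|_W`: the fundamental form restricted to `W`, extended by `0` on the
orthogonal complement of `W`. -/
def omegaOn (W : Submodule ℝ R4) (u v : R4) : ℝ := c.omega x (c.proj x W u) (c.proj x W v)

/-- The Ricci form `ρ(u, v) = Ric'(Ju, v)`, where `Ric'` is the `J`-invariant part of `Ric`. -/
def rho (u v : R4) : ℝ :=
  (1 / 2) * (c.ricci x (c.J x u) v + c.ricci x (c.J x (c.J x u)) (c.J x v))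

/-- The star-Ricci form `ρ* = R(ω)`, the image of `ω` under the curvature operator on 2-forms. -/
def rhoStar (u v : R4) : ℝ := c.inner2 x (c.curv x u v) (c.omega x)

/-- The 2-form `Φ(u, v) = ½ ⟨J(∇_u ω), ∇_v ω⟩`, where `(Jψ)(X, Y) = -ψ(JX, Y)`. -/
def Phi (u v : R4) : ℝ :=
  (1 / 2) * c.inner2 x (fun a b ↦ -c.nabla2 x c.omega u (c.J x a) b) (c.nabla2 x c.omega v)

end Coord

/-- The class `AH₁`: Gray's first curvature condition `R_{XYZW} = R_{XY JZ JW}`. -/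
def AlmostHermitian.IsAH1 {M : Type*} [TopologicalSpace M] [ChartedSpace R4 M]
    [IsManifold (𝓡 4) ∞ M] (A : AlmostHermitian M) : Prop :=
  ∀ e ∈ IsManifold.maximalAtlas (𝓡 4) ∞ M, ∀ x ∈ e.target, ∀ u v w z : R4,
    (A.inChart e).curv x u v w z
      = (A.inChart e).curv x u v ((A.inChart e).J x w) ((A.inChart e).J x z)

end

/-! Everything is local, so the work takes place in one chart, with `G` and `J` fields of operators
on `R4`. Write F for the curvature endomorphism of the Levi-Civita connection and K for the
endomorphism-valued 1-form ∇J. The condition AH₁ says exactly that every F(u,v) commutes with J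
(`curvEnd_comm_J`). The Ricci identity applied to J then gives D_u K_v = D_v K_u, that is, K is
closed for the exterior covariant derivative. Differentiating once more, the alternated commutator
of F with K vanishes (`sum_comm_curvEnd_covD`).

In dimension 4 this is a strong condition. Each K_u is skew and anticommutes with J, and such
endomorphisms form a real plane, so in an adapted frame K amounts to two real 1-forms m and n
(`nablaJRe`, `nablaJIm`). A skew F acts on this plane, modulo its complement, by rotation with speed
ρ*. The commutator condition becomes ρ* ∧ m = ρ* ∧ n = 0 (`rhoStar_wedge_nablaJ`). Since Φ = m ∧ n
(`Phi_frame`), this yields ρ* ∧ Φ = 0 and the proportionality of ρ* and Φ.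

Pair symmetry and the first Bianchi identity make Ric invariant under J and give ρ* = ρ
(`rhoStar_eq_rho`). The wedge conditions therefore become linear relations between Ric and the
components of m and n (`ricci_relations`). The Lee form and N are complementary linear combinations
of these components, and the relations combine to Ric(θ) = 0 and Ric = s/2 on Im N. The eigenvalue
statements follow, as does orthogonality where s ≠ 0, since then 0 and s/2 are distinct. Where s =
0, a sum of squares of the relations forces Ric = 0 or K = 0.

Closedness is of Chern–Weil type: up to constants ρ* is tr(JF) and Φ is tr(J K K). The second
Bianchi identity, the symmetry of DK and the vanishing of traces of the wrong J-type finish it.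
Where s and N do not vanish, a frame with e₀, e₁ spanning Im N makes m and n vanish on e₂, e₃, and
the explicit formulas are read off. The one for δθ also needs the trace of ∇²J, computed in
`delta1_lee` from its symmetry and from the second derivative of J² = -1. -/

noncomputable section

/-- Fields of bilinear forms and endomorphisms, viewed as coordinate expressions. -/
def Coord.ofFields (G : R4 → R4 →L[ℝ] R4 →L[ℝ] ℝ) (J : R4 → R4 →L[ℝ] R4) : Coord where
  g y u v := G y u v
  J y u := J y u

/-- A smooth metric `G` and a smooth `G`-orthogonal almost complex structure `J` on an open set. -/
structure IsAlmostHermitianOn (U : Set R4) (G : R4 → R4 →L[ℝ] R4 →L[ℝ] ℝ)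
    (J : R4 → R4 →L[ℝ] R4) : Prop where
  isOpen : IsOpen U
  smooth_G : ContDiffOn ℝ ∞ G U
  smooth_J : ContDiffOn ℝ ∞ J U
  symm : ∀ y ∈ U, ∀ u v, G y u v = G y v u
  pos : ∀ y ∈ U, ∀ u, u ≠ 0 → 0 < G y u u
  J_sq : ∀ y ∈ U, ∀ u, J y (J y u) = -u
  J_orth : ∀ y ∈ U, ∀ u v, G y (J y u) (J y v) = G y u v

/-! ### Smoothness and pointwise identities of the chart expressions. -/

section Chart

variable {M : Type*} [TopologicalSpace M] [ChartedSpace R4 M] [IsManifold (𝓡 4) ∞ M]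
  (A : AlmostHermitian M) (e : OpenPartialHomeomorph M R4)

/-- The differential of the inverse chart. -/
def chartSymmDeriv (y : R4) : R4 →L[ℝ] R4 := mfderiv (𝓡 4) (𝓡 4) e.symm y

/-- The differential of the chart. -/
def chartDeriv (y : R4) : R4 →L[ℝ] R4 := mfderiv (𝓡 4) (𝓡 4) e (e.symm y)

/-- The metric in a chart, as a field of continuous bilinear forms. -/
def AlmostHermitian.chartMetric (y : R4) : R4 →L[ℝ] R4 →L[ℝ] ℝ :=
  ContinuousLinearMap.bilinearComp (E := R4) (F := R4) (G := ℝ) (A.g.inner (e.symm y))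
    (chartSymmDeriv e y) (chartSymmDeriv e y)

/-- The almost complex structure in a chart, as a field of continuous endomorphisms. -/
def AlmostHermitian.chartJ (y : R4) : R4 →L[ℝ] R4 :=
  (chartDeriv e y).comp
    (ContinuousLinearMap.comp (M₂ := R4) (A.J (e.symm y)) (chartSymmDeriv e y))

/-- Bundling the values as continuous linear maps makes `G` and `J` maps into normed spaces, to
which `fderiv` applies directly. -/
theorem AlmostHermitian.inChart_eq :
    A.inChart e = Coord.ofFields (A.chartMetric e) (A.chartJ e) := rfl

variable {e}

/-- The constant field `u` is a smooth section of the tangent bundle of `R4`, and the tangent map of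
the smooth map `e.symm` carries it to this field. -/
theorem contMDiffOn_chartSymmDeriv_apply (he : e ∈ IsManifold.maximalAtlas (𝓡 4) ∞ M)
    (u : R4) :
    ContMDiffOn (𝓡 4) ((𝓡 4).prod 𝓘(ℝ, R4)) ∞
      (fun y ↦ TotalSpace.mk' R4 (E := fun p : M ↦ TangentSpace (𝓡 4) p) (e.symm y)
        (mfderiv (𝓡 4) (𝓡 4) e.symm y u)) e.target := by
  have h := (contMDiffOn_symm_of_mem_maximalAtlas he).contMDiffOn_tangentMapWithin
    (m := ∞) (by norm_num) e.open_target.uniqueMDiffOn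
  have hs : ContMDiff (𝓡 4) ((𝓡 4).prod 𝓘(ℝ, R4)) ∞
      (fun y : R4 ↦ (TotalSpace.mk' R4 y u : TangentBundle (𝓡 4) R4)) := by
    intro y
    refine contMDiffAt_totalSpace.2 ⟨contMDiffAt_id, ?_⟩
    simpa using contMDiffAt_const
  have := h.comp (hs.contMDiffOn (s := e.target)) (fun y hy ↦ hy)
  refine this.congr fun y hy ↦ ?_
  simp [tangentMapWithin, mfderivWithin_of_isOpen e.open_target hy]

/-- The tangent map of `e` is smooth, and the tangent bundle of `R4` is trivial, so the fibre
component of the image is a smooth function. -/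
theorem contDiffOn_chartDeriv_apply (he : e ∈ IsManifold.maximalAtlas (𝓡 4) ∞ M)
    (v : ∀ y : R4, TangentSpace (𝓡 4) (e.symm y))
    (hv : ContMDiffOn (𝓡 4) ((𝓡 4).prod 𝓘(ℝ, R4)) ∞
      (fun y ↦ TotalSpace.mk' R4 (E := fun p : M ↦ TangentSpace (𝓡 4) p) (e.symm y) (v y))
      e.target) :
    ContDiffOn ℝ ∞ (fun y ↦ (chartDeriv e y (v y) : R4)) e.target := by
  have h := (contMDiffOn_of_mem_maximalAtlas he).contMDiffOn_tangentMapWithin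
    (m := ∞) (by norm_num) e.open_source.uniqueMDiffOn
  have h2 := h.comp hv (fun y hy ↦ e.map_target hy)
  rw [← contMDiffOn_iff_contDiffOn]
  intro y hy
  have h3 := (contMDiffWithinAt_totalSpace.1 (h2 y hy)).2
  have h4 : ∀ z ∈ e.target, chartDeriv e z (v z) =
      (trivializationAt R4 (TangentSpace (𝓡 4)) y
        (tangentMapWithin (𝓡 4) (𝓡 4) e e.source ⟨e.symm z, v z⟩)).2 := fun z hz ↦ by
    simp [tangentMapWithin, mfderivWithin_of_isOpen e.open_source (e.map_target hz), chartDeriv]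
    rfl
  have h5 : (tangentMapWithin (𝓡 4) (𝓡 4) e e.source ⟨e.symm y, v y⟩).proj = y :=
    e.right_inv hy
  simp only [Function.comp_apply, h5] at h3
  exact h3.congr h4 (h4 y hy)

theorem contDiffOn_chartMetric (he : e ∈ IsManifold.maximalAtlas (𝓡 4) ∞ M) :
    ContDiffOn ℝ ∞ (A.chartMetric e) e.target := by
  rw [contDiffOn_clm_apply]
  intro u
  rw [contDiffOn_clm_apply]
  intro v
  rw [← contMDiffOn_iff_contDiffOn]
  intro y hy
  have hb := (contMDiffOn_symm_of_mem_maximalAtlas he) y hy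
  have : ContMDiffWithinAt (𝓡 4) ((𝓡 4).prod 𝓘(ℝ)) ∞
      (fun m ↦ TotalSpace.mk' ℝ (E := Bundle.Trivial M ℝ) (e.symm m)
        (A.g.inner (e.symm m) (mfderiv (𝓡 4) (𝓡 4) e.symm m u)
          (mfderiv (𝓡 4) (𝓡 4) e.symm m v))) e.target y := by
    apply ContMDiffWithinAt.clm_bundle_apply₂ (F₁ := R4) (F₂ := R4)
    · exact ContMDiffAt.comp_contMDiffWithinAt y A.g.contMDiff.contMDiffAt hb
    · exact contMDiffOn_chartSymmDeriv_apply he u y hy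
    · exact contMDiffOn_chartSymmDeriv_apply he v y hy
  exact (contMDiffWithinAt_totalSpace.1 this).2

theorem contDiffOn_chartJ (he : e ∈ IsManifold.maximalAtlas (𝓡 4) ∞ M) :
    ContDiffOn ℝ ∞ (A.chartJ e) e.target := by
  rw [contDiffOn_clm_apply]
  intro u
  refine contDiffOn_chartDeriv_apply he
    (fun y ↦ A.J (e.symm y) (mfderiv (𝓡 4) (𝓡 4) e.symm y u)) fun y hy ↦ ?_
  have hb := (contMDiffOn_symm_of_mem_maximalAtlas he) y hy
  exact ContMDiffWithinAt.clm_bundle_apply (F₁ := R4) (F₂ := R4)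
    (ContMDiffAt.comp_contMDiffWithinAt y A.smooth_J.contMDiffAt hb)
    (contMDiffOn_chartSymmDeriv_apply he u y hy)

omit [IsManifold (𝓡 4) ∞ M] in
theorem chartDeriv_chartSymmDeriv (he : e ∈ IsManifold.maximalAtlas (𝓡 4) ∞ M)
    {y : R4} (hy : y ∈ e.target) (u : R4) :
    chartDeriv e y (chartSymmDeriv e y u) = u ∧ chartSymmDeriv e y (chartDeriv e y u) = u := by
  have hd : e.MDifferentiable (𝓡 4) (𝓡 4) :=
    ⟨(contMDiffOn_of_mem_maximalAtlas he).mdifferentiableOn (by simp),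
      (contMDiffOn_symm_of_mem_maximalAtlas he).mdifferentiableOn (by simp)⟩
  have h1 := hd.comp_symm_deriv hy
  have h2 := hd.symm_comp_deriv (e.map_target hy)
  rw [e.right_inv hy] at h2
  exact ⟨DFunLike.congr_fun h1 u, DFunLike.congr_fun h2 u⟩

theorem AlmostHermitian.isAlmostHermitianOn_chart
    (he : e ∈ IsManifold.maximalAtlas (𝓡 4) ∞ M) :
    IsAlmostHermitianOn e.target (A.chartMetric e) (A.chartJ e) where
  isOpen := e.open_target
  smooth_G := contDiffOn_chartMetric A he
  smooth_J := contDiffOn_chartJ A he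
  symm y _ u v := A.g.symm _ _ _
  pos y hy u hu := by
    refine A.g.pos (e.symm y) (chartSymmDeriv e y u) fun h ↦ hu ?_
    rw [← (chartDeriv_chartSymmDeriv he hy u).1]
    exact (congrArg (chartDeriv e y) h).trans (map_zero _)
  J_sq y hy u := by
    have h1 : chartSymmDeriv e y (A.chartJ e y u) = A.J (e.symm y) (chartSymmDeriv e y u) :=
      (chartDeriv_chartSymmDeriv he hy _).2
    have h2 : A.J (e.symm y) (A.J (e.symm y) (chartSymmDeriv e y u)) = -(chartSymmDeriv e y u) :=
      A.J_sq _ _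
    have h3 : A.chartJ e y (A.chartJ e y u)
      = chartDeriv e y (A.J (e.symm y) (chartSymmDeriv e y (A.chartJ e y u))) := rfl
    rw [h3, h1]
    refine (congrArg (chartDeriv e y) h2).trans ?_
    rw [map_neg, (chartDeriv_chartSymmDeriv he hy u).1]
  J_orth y hy u v := by
    have h1 : ∀ u, chartSymmDeriv e y (A.chartJ e y u) = A.J (e.symm y) (chartSymmDeriv e y u) :=
      fun u ↦ (chartDeriv_chartSymmDeriv he hy _).2
    have h3 : ∀ u v, A.chartMetric e y u v
      = A.g.inner (e.symm y) (chartSymmDeriv e y u) (chartSymmDeriv e y v) := fun _ _ ↦ rfl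
    rw [h3, h3, h1, h1]
    exact A.J_orth _ _ _

end Chart
end

noncomputable section

/-! ### Directional derivatives -/

namespace Coord

section Pd

variable {F : Type*} [NormedAddCommGroup F] [NormedSpace ℝ F] {x : R4}

theorem contDiffAt_pd {f : R4 → F} (hf : ContDiffAt ℝ ∞ f x) (u : R4) :
    ContDiffAt ℝ ∞ (pd u f) x :=
  (hf.fderiv_right (m := ∞) (by norm_num)).clm_apply contDiffAt_const

theorem differentiableAt_of_smooth {f : R4 → F} (hf : ContDiffAt ℝ ∞ f x) :
    DifferentiableAt ℝ f x := hf.differentiableAt (by simp)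

theorem pd_congr {f g : R4 → F} (h : f =ᶠ[nhds x] g) (u : R4) : pd u f x = pd u g x := by
  rw [pd, pd, h.fderiv_eq]

theorem pd_comm {f : R4 → F} (hf : ContDiffAt ℝ ∞ f x) (u v : R4) :
    pd u (pd v f) x = pd v (pd u f) x := by
  have hs : IsSymmSndFDerivAt ℝ f x := hf.isSymmSndFDerivAt (by simpa using WithTop.coe_le_coe.2 (le_top : (2 : ℕ∞) ≤ ⊤))
  have hd : DifferentiableAt ℝ (fderiv ℝ f) x :=
    differentiableAt_of_smooth (hf.fderiv_right (m := ∞) (by norm_num))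
  have h : ∀ u v, pd u (pd v f) x = fderiv ℝ (fderiv ℝ f) x u v := fun u v ↦ by
    unfold pd
    rw [fderiv_clm_apply hd (differentiableAt_const v)]
    simp
  rw [h, h]
  exact hs.eq u v

theorem pd_add {f g : R4 → F} (hf : DifferentiableAt ℝ f x) (hg : DifferentiableAt ℝ g x)
    (u : R4) : pd u (fun y ↦ f y + g y) x = pd u f x + pd u g x := by
  simp [pd, fderiv_fun_add hf hg]

theorem pd_sub {f g : R4 → F} (hf : DifferentiableAt ℝ f x) (hg : DifferentiableAt ℝ g x)
    (u : R4) : pd u (fun y ↦ f y - g y) x = pd u f x - pd u g x := by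
  simp [pd, fderiv_fun_sub hf hg]

theorem pd_clm {F' : Type*} [NormedAddCommGroup F'] [NormedSpace ℝ F'] (L : F →L[ℝ] F')
    {f : R4 → F} (hf : DifferentiableAt ℝ f x) (u : R4) :
    pd u (fun y ↦ L (f y)) x = L (pd u f x) := by
  exact DFunLike.congr_fun (L.hasFDerivAt.comp x hf.hasFDerivAt).fderiv u

theorem pd_clm_apply {F' : Type*} [NormedAddCommGroup F'] [NormedSpace ℝ F']
    {A : R4 → F →L[ℝ] F'} {f : R4 → F} (hA : DifferentiableAt ℝ A x) (hf : DifferentiableAt ℝ f x)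
    (u : R4) : pd u (fun y ↦ A y (f y)) x = pd u A x (f x) + A x (pd u f x) := by
  simp only [pd]
  rw [fderiv_clm_apply hA hf]
  simp [add_comm]

theorem pd_clm_apply_const {F' : Type*} [NormedAddCommGroup F'] [NormedSpace ℝ F']
    {A : R4 → F →L[ℝ] F'} (hA : DifferentiableAt ℝ A x) (u : R4) (v : F) :
    pd u (fun y ↦ A y v) x = pd u A x v := by
  rw [pd_clm_apply hA (differentiableAt_const v)]
  simp [pd]

theorem pd_mul {𝔸 : Type*} [NormedRing 𝔸] [NormedAlgebra ℝ 𝔸] {A B : R4 → 𝔸} (hA : DifferentiableAt ℝ A x)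
    (hB : DifferentiableAt ℝ B x) (u : R4) :
    pd u (fun y ↦ A y * B y) x = pd u A x * B x + A x * pd u B x := by
  simp only [pd]
  rw [fderiv_fun_mul' hA hB]
  simp [add_comm]

theorem pd_const (a : F) (u : R4) : pd u (fun _ ↦ a) x = 0 := by simp [pd]

theorem pd_const_mul {f : R4 → ℝ} (hf : DifferentiableAt ℝ f x) (r : ℝ) (u : R4) :
    pd u (fun y ↦ r * f y) x = r * pd u f x := by
  simp [pd, fderiv_const_mul hf]

theorem pd_add_dir (f : R4 → F) (u v : R4) : pd (u + v) f x = pd u f x + pd v f x :=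
  map_add _ _ _

theorem pd_smul_dir (f : R4 → F) (r : ℝ) (u : R4) : pd (r • u) f x = r • pd u f x :=
  map_smul _ _ _

end Pd

end Coord

/-! ### Connections on trivial bundles of algebras -/

namespace Connection

open Coord

variable {𝔸 : Type*} [NormedRing 𝔸] [NormedAlgebra ℝ 𝔸] (Γ : R4 → R4 → 𝔸)

/-- The covariant derivative of a field of endomorphisms for the connection with connection
form `Γ`. -/
def covD (u : R4) (A : R4 → 𝔸) (y : R4) : 𝔸 :=
  pd u A y + Γ u y * A y - A y * Γ u y

/-- The curvature form of the connection with connection form `Γ`. -/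
def curvEnd (u v : R4) (y : R4) : 𝔸 :=
  pd u (Γ v) y - pd v (Γ u) y + Γ u y * Γ v y - Γ v y * Γ u y

variable {Γ} {x : R4}

theorem contDiffAt_covD (hΓ : ∀ u, ContDiffAt ℝ ∞ (Γ u) x) {A : R4 → 𝔸}
    (hA : ContDiffAt ℝ ∞ A x) (u : R4) : ContDiffAt ℝ ∞ (covD Γ u A) x :=
  ((contDiffAt_pd hA u).add ((hΓ u).mul hA)).sub (hA.mul (hΓ u))

theorem contDiffAt_curvEnd (hΓ : ∀ u, ContDiffAt ℝ ∞ (Γ u) x) (u v : R4) :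
    ContDiffAt ℝ ∞ (curvEnd Γ u v) x :=
  (((contDiffAt_pd (hΓ v) u).sub (contDiffAt_pd (hΓ u) v)).add ((hΓ u).mul (hΓ v))).sub
    ((hΓ v).mul (hΓ u))

theorem covD_congr {A B : R4 → 𝔸} (h : A =ᶠ[nhds x] B) (u : R4) :
    covD Γ u A x = covD Γ u B x := by
  rw [covD, covD, pd_congr h, h.eq_of_nhds]

theorem covD_zero (u : R4) : covD Γ u (fun _ ↦ 0) x = 0 := by
  simp [covD, pd_const]

theorem covD_add {A B : R4 → 𝔸} (hA : DifferentiableAt ℝ A x)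
    (hB : DifferentiableAt ℝ B x) (u : R4) :
    covD Γ u (fun y ↦ A y + B y) x = covD Γ u A x + covD Γ u B x := by
  simp only [covD, pd_add hA hB]
  noncomm_ring

theorem covD_sub {A B : R4 → 𝔸} (hA : DifferentiableAt ℝ A x)
    (hB : DifferentiableAt ℝ B x) (u : R4) :
    covD Γ u (fun y ↦ A y - B y) x = covD Γ u A x - covD Γ u B x := by
  simp only [covD, pd_sub hA hB]
  noncomm_ring

theorem covD_mul {A B : R4 → 𝔸} (hA : DifferentiableAt ℝ A x)
    (hB : DifferentiableAt ℝ B x) (u : R4) :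
    covD Γ u (fun y ↦ A y * B y) x = covD Γ u A x * B x + A x * covD Γ u B x := by
  simp only [covD, pd_mul hA hB]
  noncomm_ring

theorem pd_covD (hΓ : ∀ u, ContDiffAt ℝ ∞ (Γ u) x) {A : R4 → 𝔸}
    (hA : ContDiffAt ℝ ∞ A x) (u v : R4) :
    pd u (covD Γ v A) x = pd u (pd v A) x + (pd u (Γ v) x * A x + Γ v x * pd u A x)
      - (pd u A x * Γ v x + A x * pd u (Γ v) x) := by
  have dA := differentiableAt_of_smooth hA
  have dΓ := fun u ↦ differentiableAt_of_smooth (hΓ u)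
  have dpA := differentiableAt_of_smooth (contDiffAt_pd hA v)
  unfold covD
  rw [pd_sub (dpA.fun_add ((dΓ v).fun_mul dA)) (dA.fun_mul (dΓ v)), pd_add dpA ((dΓ v).fun_mul dA),
    pd_mul (dΓ v) dA, pd_mul dA (dΓ v)]

/-- The Ricci identity: the curvature measures the failure of covariant derivatives to commute. -/
theorem covD_comm (hΓ : ∀ u, ContDiffAt ℝ ∞ (Γ u) x) {A : R4 → 𝔸}
    (hA : ContDiffAt ℝ ∞ A x) (u v : R4) :
    covD Γ u (covD Γ v A) x - covD Γ v (covD Γ u A) x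
      = curvEnd Γ u v x * A x - A x * curvEnd Γ u v x := by
  have h : ∀ u v, covD Γ u (covD Γ v A) x = pd u (covD Γ v A) x + Γ u x * covD Γ v A x
    - covD Γ v A x * Γ u x := fun _ _ ↦ rfl
  rw [h, h, pd_covD hΓ hA, pd_covD hΓ hA, pd_comm hA u v]
  simp only [covD, curvEnd]
  noncomm_ring

/-- The second Bianchi identity. -/
theorem bianchi_curvEnd (hΓ : ∀ u, ContDiffAt ℝ ∞ (Γ u) x) (u v w : R4) :
    covD Γ w (curvEnd Γ u v) x + covD Γ u (curvEnd Γ v w) x + covD Γ v (curvEnd Γ w u) x = 0 := by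
  have dΓ := fun u ↦ differentiableAt_of_smooth (hΓ u)
  have dpΓ := fun u v ↦ differentiableAt_of_smooth (contDiffAt_pd (hΓ u) v)
  have h : ∀ u v w, pd w (curvEnd Γ u v) x = pd w (pd u (Γ v)) x - pd w (pd v (Γ u)) x
      + (pd w (Γ u) x * Γ v x + Γ u x * pd w (Γ v) x)
      - (pd w (Γ v) x * Γ u x + Γ v x * pd w (Γ u) x) := fun u v w ↦ by
    unfold curvEnd
    rw [pd_sub (((dpΓ v u).fun_sub (dpΓ u v)).fun_add ((dΓ u).fun_mul (dΓ v))) ((dΓ v).fun_mul (dΓ u)),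
      pd_add ((dpΓ v u).fun_sub (dpΓ u v)) ((dΓ u).fun_mul (dΓ v)), pd_sub (dpΓ v u) (dpΓ u v),
      pd_mul (dΓ u) (dΓ v), pd_mul (dΓ v) (dΓ u)]
  simp only [covD, h]
  rw [pd_comm (hΓ v) w u, pd_comm (hΓ u) w v, pd_comm (hΓ w) u v]
  simp only [curvEnd]
  noncomm_ring

theorem pd_tr {tr : 𝔸 →L[ℝ] ℝ} (htr : ∀ a b, tr (a * b) = tr (b * a))
    {A : R4 → 𝔸} (hA : DifferentiableAt ℝ A x) (u : R4) :
    pd u (fun y ↦ tr (A y)) x = tr (covD Γ u A x) := by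
  rw [pd_clm tr hA, covD, map_sub, map_add, htr (Γ u x)]
  ring

/-- If an almost complex structure commutes with the curvature at `x`, its covariant derivative
`K` satisfies `D_u K_v = D_v K_u`. -/
theorem covD_covD_symm (hΓ : ∀ u, ContDiffAt ℝ ∞ (Γ u) x) {J : R4 → 𝔸}
    (hJ : ContDiffAt ℝ ∞ J x) (u v : R4)
    (hF : curvEnd Γ u v x * J x = J x * curvEnd Γ u v x) :
    covD Γ u (covD Γ v J) x = covD Γ v (covD Γ u J) x := by
  rw [← sub_eq_zero, covD_comm hΓ hJ, hF, sub_self]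

/-- If `D_u K_v = D_v K_u` near `x`, the curvature commutes with `K` after alternation. -/
theorem sum_comm_curvEnd_covD (hΓ : ∀ u, ∀ᶠ y in nhds x, ContDiffAt ℝ ∞ (Γ u) y)
    {J : R4 → 𝔸} (hJ : ∀ᶠ y in nhds x, ContDiffAt ℝ ∞ J y)
    (hs : ∀ u v, ∀ᶠ y in nhds x, covD Γ u (covD Γ v J) y = covD Γ v (covD Γ u J) y)
    (u v w : R4) :
    (curvEnd Γ u v x * covD Γ w J x - covD Γ w J x * curvEnd Γ u v x)
      + (curvEnd Γ v w x * covD Γ u J x - covD Γ u J x * curvEnd Γ v w x)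
      + (curvEnd Γ w u x * covD Γ v J x - covD Γ v J x * curvEnd Γ w u x) = 0 := by
  have hΓ' := fun u ↦ (hΓ u).self_of_nhds
  have hK := fun w ↦ contDiffAt_covD hΓ' hJ.self_of_nhds w
  rw [← covD_comm hΓ' (hK w), ← covD_comm hΓ' (hK u), ← covD_comm hΓ' (hK v),
    covD_congr (hs v w) u, covD_congr (hs u w) v, covD_congr (hs u v) w]
  abel

/-! ### Closedness of trace forms built from J, its curvature and its derivative. -/

section Closed

variable {J : R4 → 𝔸}

/-- An endomorphism commuting with `J`, times one anticommuting with `J`, has trace zero. -/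
theorem tr_mul_eq_zero {tr : 𝔸 →L[ℝ] ℝ} (htr : ∀ a b, tr (a * b) = tr (b * a))
    {J A B : 𝔸} (hJ : J * J = -1) (hA : A * J = J * A)
    (hB : B * J = -(J * B)) : tr (A * B) = 0 := by
  -- The trace of JABJ is computed twice: by cyclicity it is -tr(AB), and by moving J through B and
  -- A it is tr(AB).
  have h1 : tr (J * (A * B) * J) = -tr (A * B) := by
    rw [htr, ← mul_assoc, hJ]
    simp
  have h2 : J * (A * B) * J = A * B := by
    calc J * (A * B) * J = J * A * (B * J) := by noncomm_ring
      _ = -(J * A * J * B) := by rw [hB]; noncomm_ring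
      _ = -(J * (A * J) * B) := by noncomm_ring
      _ = -(J * J * A * B) := by rw [hA]; noncomm_ring
      _ = A * B := by rw [hJ]; noncomm_ring
  rw [h2] at h1
  linarith

/-- Leibniz rule applied to J² = -1. -/
theorem covD_anticomm (hJ : DifferentiableAt ℝ J x)
    (hsq : ∀ᶠ y in nhds x, J y * J y = -1) (u : R4) :
    covD Γ u J x * J x = -(J x * covD Γ u J x) := by
  have h : covD Γ u (fun y ↦ J y * J y) x = covD Γ u (fun _ ↦ (-1 : 𝔸)) x :=
    covD_congr hsq u
  rw [covD_mul hJ hJ] at h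
  simp only [covD, pd_const] at h ⊢
  rw [← sub_eq_zero] at h ⊢
  rw [← h]
  noncomm_ring

/-- Second derivative of J² = -1: the part of DK commuting with J is quadratic in K. -/
theorem covD_covD_anticomm (hΓ : ∀ u, ContDiffAt ℝ ∞ (Γ u) x)
    (hJ : ∀ᶠ y in nhds x, ContDiffAt ℝ ∞ J y) (hsq : ∀ᶠ y in nhds x, J y * J y = -1) (u w : R4) :
    J x * covD Γ w (covD Γ u J) x + covD Γ w (covD Γ u J) x * J x
      = -(covD Γ u J x * covD Γ w J x) - covD Γ w J x * covD Γ u J x := by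
  have dJ := differentiableAt_of_smooth hJ.self_of_nhds
  have dK := differentiableAt_of_smooth (contDiffAt_covD hΓ hJ.self_of_nhds u)
  have h0 : covD Γ w (fun y ↦ covD Γ u J y * J y + J y * covD Γ u J y) x = 0 := by
    rw [covD_congr (B := fun _ ↦ 0), covD_zero]
    filter_upwards [hJ, hsq.eventually_nhds] with y hy hy'
    rw [covD_anticomm (differentiableAt_of_smooth hy) hy', neg_add_cancel]
  rw [covD_add (dK.fun_mul dJ) (dJ.fun_mul dK), covD_mul dK dJ, covD_mul dJ dK] at h0
  rw [← sub_eq_zero, ← h0]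
  noncomm_ring

/-- In the derivative of tr(JF) the term tr(DJ · F) vanishes, because F commutes and DJ anticommutes
with J. What remains alternates to zero by the second Bianchi identity. -/
theorem extd_trace_curvEnd {tr : 𝔸 →L[ℝ] ℝ} (htr : ∀ a b, tr (a * b) = tr (b * a))
    (hΓ : ∀ u, ContDiffAt ℝ ∞ (Γ u) x) (hJ : ContDiffAt ℝ ∞ J x)
    (hsq : ∀ᶠ y in nhds x, J y * J y = -1)
    (hF : ∀ u v, curvEnd Γ u v x * J x = J x * curvEnd Γ u v x) (u v w : R4) :
    extd (fun y u v ↦ tr (J y * curvEnd Γ u v y)) x u v w = 0 := by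
  have dJ := differentiableAt_of_smooth hJ
  have dF := fun u v ↦ differentiableAt_of_smooth (contDiffAt_curvEnd hΓ u v)
  have h : ∀ u v w, pd w (fun y ↦ tr (J y * curvEnd Γ u v y)) x
      = tr (J x * covD Γ w (curvEnd Γ u v) x) := fun u v w ↦ by
    rw [pd_tr (Γ := Γ) htr (dJ.fun_mul (dF u v)), covD_mul dJ (dF u v), map_add, htr,
      tr_mul_eq_zero htr hsq.self_of_nhds (hF u v) (covD_anticomm dJ hsq w), zero_add]
  have hneg : curvEnd Γ w u = fun y ↦ 0 - curvEnd Γ u w y := by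
    funext y; simp only [curvEnd]; abel
  have hb := bianchi_curvEnd hΓ u v w
  rw [hneg, covD_sub (differentiableAt_const 0) (dF u w), covD_zero] at hb
  simp only [extd, h]
  rw [← map_sub, ← map_add, ← mul_sub, ← mul_add, ← map_zero tr, ← mul_zero (J x), ← hb]
  congr 2
  abel

/-- A product of two K's commutes with J, so differentiating the factor J contributes nothing. By
the symmetry of DK the other terms cancel, except for one pair, which vanishes by
`covD_covD_anticomm`. -/
theorem extd_trace_covD {tr : 𝔸 →L[ℝ] ℝ} (htr : ∀ a b, tr (a * b) = tr (b * a))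
    (hΓ : ∀ u, ContDiffAt ℝ ∞ (Γ u) x)
    (hJ' : ∀ᶠ y in nhds x, ContDiffAt ℝ ∞ J y) (hsq : ∀ᶠ y in nhds x, J y * J y = -1)
    (hs : ∀ u v, covD Γ u (covD Γ v J) x = covD Γ v (covD Γ u J) x) (u v w : R4) :
    extd (fun y u v ↦ tr (J y * (covD Γ v J y * covD Γ u J y))) x u v w = 0 := by
  have hJ := hJ'.self_of_nhds
  have dJ := differentiableAt_of_smooth hJ
  have dK := fun u ↦ differentiableAt_of_smooth (contDiffAt_covD hΓ hJ u)
  have hJJ := hsq.self_of_nhds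
  have ha := covD_anticomm (Γ := Γ) dJ hsq
  have hc : ∀ u v, covD Γ v J x * covD Γ u J x * J x = J x * (covD Γ v J x * covD Γ u J x) :=
    fun u v ↦ by
      rw [mul_assoc, ha, mul_neg, ← mul_assoc, ha, neg_mul, neg_neg, mul_assoc]
  have h : ∀ u v w, pd w (fun y ↦ tr (J y * (covD Γ v J y * covD Γ u J y))) x
      = tr (J x * (covD Γ w (covD Γ v J) x * covD Γ u J x))
        + tr (J x * (covD Γ v J x * covD Γ w (covD Γ u J) x)) := fun u v w ↦ by
    rw [pd_tr (Γ := Γ) htr (dJ.fun_mul ((dK v).fun_mul (dK u))), covD_mul dJ ((dK v).fun_mul (dK u)), map_add,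
      htr, tr_mul_eq_zero htr hJJ (hc u v) (ha w), zero_add, covD_mul (dK v) (dK u),
      mul_add, map_add]
  -- By cyclicity this is the trace of (J·DK + DK·J)·K. The anticommutator is quadratic in K, so the
  -- product is cubic in K and each term has trace zero by J-type.
  have hD : tr (J x * (covD Γ w (covD Γ u J) x * covD Γ v J x))
      + tr (J x * (covD Γ v J x * covD Γ w (covD Γ u J) x)) = 0 := by
    have h1 := covD_covD_anticomm hΓ hJ' hsq u w
    rw [htr (J x) (covD Γ v J x * covD Γ w (covD Γ u J) x), mul_assoc, htr (covD Γ v J x),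
      ← mul_assoc, ← map_add, ← add_mul, h1, sub_mul, neg_mul, map_sub, map_neg,
      tr_mul_eq_zero htr hJJ (hc w u) (ha v), tr_mul_eq_zero htr hJJ (hc u w) (ha v)]
    simp
  simp only [extd, h]
  rw [hs u w, hs u v, hs v w]
  linarith

end Closed

/-- The trace of an endomorphism of `R4`, as a continuous linear form. -/
def trEnd : (R4 →L[ℝ] R4) →L[ℝ] ℝ :=
  LinearMap.toContinuousLinearMap
    ((LinearMap.trace ℝ R4).comp (ContinuousLinearMap.coeLM ℝ))

theorem trEnd_mul_comm (A B : R4 →L[ℝ] R4) : trEnd (A * B) = trEnd (B * A) :=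
  LinearMap.trace_mul_comm ℝ (A : R4 →ₗ[ℝ] R4) (B : R4 →ₗ[ℝ] R4)

theorem trEnd_eq_sum (A : R4 →L[ℝ] R4) : trEnd A = ∑ i, A (basisVec i) i := by
  have : trEnd A = LinearMap.trace ℝ R4 (A : R4 →ₗ[ℝ] R4) := rfl
  rw [this, LinearMap.trace_eq_matrix_trace ℝ (EuclideanSpace.basisFun (Fin 4) ℝ).toBasis,
    Matrix.trace]
  simp [LinearMap.toMatrix_apply, basisVec]

end Connection
end

noncomputable section

/-! ### Orthonormal frames at a point -/

namespace Coord

/-- A frame of `R4` that is orthonormal for the bilinear form `B`. -/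
def IsFrame (B : R4 →L[ℝ] R4 →L[ℝ] ℝ) (E : Fin 4 → R4) : Prop :=
  ∀ i j, B (E i) (E j) = if i = j then 1 else 0

/-- Bilinear maps, as a predicate on functions. -/
structure IsBilin (T : R4 → R4 → ℝ) : Prop where
  add_left : ∀ u u' v, T (u + u') v = T u v + T u' v
  smul_left : ∀ (r : ℝ) u v, T (r • u) v = r * T u v
  add_right : ∀ u v v', T u (v + v') = T u v + T u v'
  smul_right : ∀ (r : ℝ) u v, T u (r • v) = r * T u v

theorem eq_sum_basisVec (u : R4) : u = ∑ i, u i • basisVec i := by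
  have := (EuclideanSpace.basisFun (Fin 4) ℝ).sum_repr u
  simpa [basisVec] using this.symm

theorem IsBilin.eq_sum {T : R4 → R4 → ℝ} (hT : IsBilin T) {ι κ : Type*} (s : Finset ι)
    (t : Finset κ) (a : ι → ℝ) (b : κ → ℝ) (X : ι → R4) (Y : κ → R4) :
    T (∑ i ∈ s, a i • X i) (∑ j ∈ t, b j • Y j) = ∑ i ∈ s, ∑ j ∈ t, a i * b j * T (X i) (Y j) := by
  let L : R4 →ₗ[ℝ] R4 →ₗ[ℝ] ℝ := LinearMap.mk₂ ℝ T hT.add_left hT.smul_left hT.add_right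
    hT.smul_right
  have h : ∀ u v, T u v = L u v := fun _ _ ↦ rfl
  simp only [h, map_sum, LinearMap.sum_apply, map_smul, LinearMap.smul_apply, smul_eq_mul]
  rw [Finset.sum_comm]
  simp only [Finset.mul_sum]
  exact Finset.sum_congr rfl fun i _ ↦ Finset.sum_congr rfl fun j _ ↦ by ring

section Frame

variable {G : R4 → R4 →L[ℝ] R4 →L[ℝ] ℝ} {J : R4 → R4 →L[ℝ] R4} {y : R4} {E : Fin 4 → R4}

theorem isBilin_clm (B : R4 →L[ℝ] R4 →L[ℝ] ℝ) : IsBilin fun u v ↦ B u v := by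
  constructor <;> simp

/-- With P the matrix whose columns are the frame vectors, orthonormality reads PᵀgP = 1. A
one-sided inverse of a square matrix is two-sided, so PPᵀ inverts g. -/
theorem IsFrame.gram_mul (hE : IsFrame (G y) E) :
    (Matrix.of fun k l ↦ (ofFields G J).g y (basisVec k) (basisVec l))
      * ((Matrix.of fun i k ↦ E k i) * (Matrix.of fun i k ↦ E k i).transpose) = 1 := by
  rw [← mul_assoc]
  apply mul_eq_one_comm.1
  ext k l
  have h := (isBilin_clm (G y)).eq_sum Finset.univ Finset.univ (E k) (E l) basisVec basisVec
  rw [← eq_sum_basisVec, ← eq_sum_basisVec, hE k l] at h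
  simp only [Matrix.mul_apply, Matrix.of_apply, Matrix.transpose_apply, Matrix.one_apply, h,
    ofFields, Finset.mul_sum]
  exact Finset.sum_congr rfl fun i _ ↦ Finset.sum_congr rfl fun j _ ↦ by ring

theorem IsFrame.det_ne_zero (hE : IsFrame (G y) E) :
    (Matrix.of fun k l ↦ (ofFields G J).g y (basisVec k) (basisVec l)).det ≠ 0 := by
  have h := congrArg Matrix.det (hE.gram_mul (J := J))
  rw [Matrix.det_mul, Matrix.det_one] at h
  exact left_ne_zero_of_mul_eq_one h

theorem IsFrame.ginv_eq (hE : IsFrame (G y) E) (i j : Fin 4) :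
    (ofFields G J).ginv y i j = ∑ k, E k i * E k j := by
  rw [ginv, Matrix.inv_eq_right_inv hE.gram_mul]
  simp [Matrix.mul_apply]

/-- Converts the traces against the inverse metric in the definitions into sums over an orthonormal
frame. -/
theorem IsFrame.tr_eq (hE : IsFrame (G y) E) {T : R4 → R4 → ℝ} (hT : IsBilin T) :
    (ofFields G J).tr y T = ∑ k, T (E k) (E k) := by
  have h : ∀ k, T (E k) (E k) = ∑ i, ∑ j, E k i * E k j * T (basisVec i) (basisVec j) := fun k ↦ by
    rw [← hT.eq_sum, ← eq_sum_basisVec]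
  simp only [tr, hE.ginv_eq, h, Finset.sum_mul]
  rw [Finset.sum_comm' (t' := Finset.univ) (s' := fun _ ↦ Finset.univ) (by simp)]
  rw [Finset.sum_comm]
  conv_rhs => rw [Finset.sum_comm]
  refine Finset.sum_congr rfl fun i _ ↦ ?_
  rw [Finset.sum_comm]

theorem IsFrame.sharp_eq (hE : IsFrame (G y) E) (α : R4 →ₗ[ℝ] ℝ) :
    (ofFields G J).sharp y α = ∑ k, α (E k) • E k := by
  have h : ∀ k, α (E k) • E k = ∑ i, ∑ j, (E k i * E k j * α (basisVec i)) • basisVec j := by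
    intro k
    have hα : α (E k) = ∑ i, E k i * α (basisVec i) := by
      conv_lhs => rw [eq_sum_basisVec (E k)]
      simp
    rw [hα, Finset.sum_smul]
    refine Finset.sum_congr rfl fun i _ ↦
      (congrArg (fun v ↦ (E k i * α (basisVec i)) • v) (eq_sum_basisVec (E k))).trans ?_
    simp only [Finset.smul_sum, smul_smul]
    exact Finset.sum_congr rfl fun j _ ↦ by ring_nf
  simp only [sharp, hE.ginv_eq, h, Finset.sum_mul, Finset.sum_smul]
  conv_rhs => rw [Finset.sum_comm]
  refine Finset.sum_congr rfl fun i _ ↦ ?_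
  rw [Finset.sum_comm]

theorem IsFrame.eq_sum (hE : IsFrame (G y) E) (u : R4) :
    u = ∑ k, G y u (E k) • E k := by
  have hli : LinearIndependent ℝ E := by
    rw [Fintype.linearIndependent_iff]
    intro a ha i
    have := congrArg (fun v ↦ G y v (E i)) ha
    simpa [hE _ i] using this
  let b := basisOfLinearIndependentOfCardEqFinrank hli (by simp)
  have hb : ⇑b = E := coe_basisOfLinearIndependentOfCardEqFinrank hli (by simp)
  have hu := b.sum_repr u
  rw [hb] at hu
  have hk : ∀ k, G y u (E k) = b.repr u k := fun k ↦ by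
    conv_lhs => rw [← hu]
    simp [hE _ k]
  simp only [hk]
  exact hu.symm

theorem IsFrame.metric_sharp (hE : IsFrame (G y) E) (hs : ∀ u v, G y u v = G y v u)
    (α : R4 →ₗ[ℝ] ℝ) (w : R4) : G y ((ofFields G J).sharp y α) w = α w := by
  rw [hE.sharp_eq]
  conv_rhs => rw [hE.eq_sum w]
  simp [mul_comm, hs w]

theorem IsFrame.trace_eq (hE : IsFrame (G y) E) (L : R4 →ₗ[ℝ] R4) :
    ∑ i, L (basisVec i) i = ∑ k, G y (L (E k)) (E k) := by
  have h : ∀ i, L (basisVec i) i = ∑ k, G y (basisVec i) (E k) * (L (E k) i) := fun i ↦ by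
    conv_lhs => rw [hE.eq_sum (basisVec i)]
    simp
  have h' : ∀ k, G y (L (E k)) (E k) = ∑ i, L (E k) i * G y (basisVec i) (E k) := fun k ↦ by
    conv_lhs => rw [eq_sum_basisVec (L (E k))]
    simp
  simp only [h, h']
  rw [Finset.sum_comm]
  exact Finset.sum_congr rfl fun i _ ↦ Finset.sum_congr rfl fun j _ ↦ by ring

end Frame

/-- An orthonormal frame adapted to the almost complex structure `J`. -/
structure IsAdaptedFrame (B : R4 →L[ℝ] R4 →L[ℝ] ℝ) (J : R4 →L[ℝ] R4) (E : Fin 4 → R4) :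
    Prop where
  isFrame : IsFrame B E
  J_zero : J (E 0) = E 1
  J_one : J (E 1) = -E 0
  J_two : J (E 2) = E 3
  J_three : J (E 3) = -E 2

theorem exists_unit {B : R4 →L[ℝ] R4 →L[ℝ] ℝ} (pos : ∀ u, u ≠ 0 → 0 < B u u) {u : R4}
    (hu : u ≠ 0) : ∃ r : ℝ, r ≠ 0 ∧ B (r • u) (r • u) = 1 := by
  have h := pos u hu
  refine ⟨(√(B u u))⁻¹, by positivity, ?_⟩
  have : √(B u u) ≠ 0 := by positivity
  simp only [map_smul, smul_apply, smul_eq_mul]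
  field_simp
  rw [Real.sq_sqrt h.le]

theorem exists_isAdaptedFrame {B : R4 →L[ℝ] R4 →L[ℝ] ℝ} {J : R4 →L[ℝ] R4}
    (symm : ∀ u v, B u v = B v u) (pos : ∀ u, u ≠ 0 → 0 < B u u) (J_sq : ∀ u, J (J u) = -u)
    (J_orth : ∀ u v, B (J u) (J v) = B u v) {a₀ : R4} (ha₀ : a₀ ≠ 0) :
    ∃ E, IsAdaptedFrame B J E ∧ ∃ r : ℝ, r ≠ 0 ∧ E 0 = r • a₀ := by
  have skew : ∀ u v, B (J u) v = -B u (J v) := fun u v ↦ by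
    rw [← J_orth u (J v), J_sq]; simp
  have skew0 : ∀ u, B (J u) u = 0 := fun u ↦ by
    have h1 := skew u u
    rw [symm u] at h1
    linarith
  obtain ⟨r, hr0, hr⟩ := exists_unit pos ha₀
  set a := r • a₀ with ha
  let L : R4 →ₗ[ℝ] (Fin 2 → ℝ) := LinearMap.pi ![(B a : R4 →ₗ[ℝ] ℝ), (B (J a) : R4 →ₗ[ℝ] ℝ)]
  -- Two linear conditions on a 4-dimensional space leave a nonzero vector orthogonal to `a` and `J
  -- a`. Skewness of J makes its image under J orthogonal to them as well.
  obtain ⟨z, hz, hz0⟩ : ∃ z ∈ LinearMap.ker L, z ≠ 0 := by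
    refine (Submodule.ne_bot_iff _).1 (LinearMap.ker_ne_bot_of_finrank_lt ?_)
    simp
  obtain ⟨t, -, ht⟩ := exists_unit pos hz0
  have hz1 : B a (t • z) = 0 := by
    have := congrFun (LinearMap.mem_ker.1 hz) 0
    simp only [L, LinearMap.pi_apply, Matrix.cons_val_zero, Pi.zero_apply,
      ContinuousLinearMap.coe_coe] at this
    simp [this]
  have hz2 : B (J a) (t • z) = 0 := by
    have := congrFun (LinearMap.mem_ker.1 hz) 1
    simp only [L, LinearMap.pi_apply, Matrix.cons_val_one, Matrix.cons_val_zero, Pi.zero_apply,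
      ContinuousLinearMap.coe_coe] at this
    simp [this]
  set b := t • z
  have hz3 : B a (J b) = 0 := by have := skew a b; linarith
  have sa := skew0 a
  have sb := skew0 b
  refine ⟨![a, J a, b, J b], ⟨?_, rfl, J_sq a, rfl, J_sq b⟩, r, hr0, rfl⟩
  intro i j
  fin_cases i <;> fin_cases j <;>
    simp [J_orth, hr, ht, hz1, hz2, hz3, sa, sb, symm a (J a), symm b (J b), symm b a,
      symm b (J a), symm (J b) a]

end Coord
end

noncomputable section

/-! ### The Levi-Civita connection in coordinates -/

namespace Coord

/-- The endomorphisms `v ↦ ∇_u v` of the Levi-Civita connection of `G` in coordinates. -/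
def lc (G : R4 → R4 →L[ℝ] R4 →L[ℝ] ℝ) (u y : R4) : R4 →L[ℝ] R4 :=
  LinearMap.toContinuousLinearMap
    { toFun := fun v ↦ (ofFields G 0).sharp y fun w ↦
        (1 / 2) * (pd u G y v w + pd v G y u w - pd w G y u v)
      map_add' := fun v v' ↦ by
        simp only [sharp, ← Finset.sum_add_distrib, ← add_smul, map_add, add_apply, pd_add_dir]
        refine Finset.sum_congr rfl fun i _ ↦ Finset.sum_congr rfl fun j _ ↦ ?_
        ring_nf
      map_smul' := fun r v ↦ by
        simp only [sharp, Finset.smul_sum, smul_smul, map_smul, smul_apply, smul_eq_mul, pd_smul_dir,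
          RingHom.id_apply]
        refine Finset.sum_congr rfl fun i _ ↦ Finset.sum_congr rfl fun j _ ↦ ?_
        ring_nf }

theorem lc_apply (G : R4 → R4 →L[ℝ] R4 →L[ℝ] ℝ) (u y v : R4) :
    lc G u y v = (ofFields G 0).sharp y fun w ↦
        (1 / 2) * (pd u G y v w + pd v G y u w - pd w G y u v) := rfl

theorem lc_add (G : R4 → R4 →L[ℝ] R4 →L[ℝ] ℝ) (u u' : R4) :
    lc G (u + u') = fun y ↦ lc G u y + lc G u' y := by
  funext y
  ext1 v
  simp only [lc_apply, add_apply, sharp, ← Finset.sum_add_distrib, ← add_smul, map_add, pd_add_dir]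
  refine Finset.sum_congr rfl fun i _ ↦ Finset.sum_congr rfl fun j _ ↦ ?_
  ring_nf

theorem lc_smul (G : R4 → R4 →L[ℝ] R4 →L[ℝ] ℝ) (r : ℝ) (u : R4) :
    lc G (r • u) = fun y ↦ r • lc G u y := by
  funext y
  ext1 v
  simp only [lc_apply, smul_apply, sharp, Finset.smul_sum, smul_smul, map_smul, smul_eq_mul, pd_smul_dir]
  refine Finset.sum_congr rfl fun i _ ↦ Finset.sum_congr rfl fun j _ ↦ ?_
  ring_nf

end Coord

namespace IsAlmostHermitianOn

open Coord Connection

variable {U : Set R4} {G : R4 → R4 →L[ℝ] R4 →L[ℝ] ℝ} {J : R4 → R4 →L[ℝ] R4}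
  (h : IsAlmostHermitianOn U G J) {y : R4} (hy : y ∈ U)

include h hy

theorem eventually_mem : ∀ᶠ z in nhds y, z ∈ U := h.isOpen.mem_nhds hy

theorem contDiffAt_G : ContDiffAt ℝ ∞ G y := h.smooth_G.contDiffAt (h.isOpen.mem_nhds hy)

theorem contDiffAt_J : ContDiffAt ℝ ∞ J y := h.smooth_J.contDiffAt (h.isOpen.mem_nhds hy)

theorem exists_isAdaptedFrame_smul {a : R4} (ha : a ≠ 0) :
    ∃ E, IsAdaptedFrame (G y) (J y) E ∧ ∃ r : ℝ, r ≠ 0 ∧ E 0 = r • a :=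
  exists_isAdaptedFrame (h.symm y hy) (h.pos y hy) (h.J_sq y hy) (h.J_orth y hy) ha

theorem exists_isFrame : ∃ E, IsFrame (G y) E :=
  (h.exists_isAdaptedFrame_smul hy (a := basisVec 0) (by simp [basisVec])).imp
    fun _ hE ↦ hE.1.isFrame

theorem ext_metric {a b : R4} (hab : ∀ w, G y a w = G y b w) : a = b := by
  by_contra hne
  have := h.pos y hy (a - b) (sub_ne_zero.2 hne)
  simp [hab] at this

theorem J_skew (u v : R4) : G y (J y u) v = -G y u (J y v) := by
  rw [← h.J_orth y hy u (J y v), h.J_sq y hy]; simp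

theorem J_mul_J : J y * J y = -1 := by
  ext1 u; exact h.J_sq y hy u

theorem pd_metric_const (u v w : R4) : pd u (fun z ↦ G z v w) y = pd u G y v w := by
  have hd := differentiableAt_of_smooth (h.contDiffAt_G hy)
  rw [pd_clm_apply_const (A := fun z ↦ G z v) (hd.clm_apply (differentiableAt_const v)),
    pd_clm_apply_const hd]

theorem pd_metric_symm (u v w : R4) : pd u G y v w = pd u G y w v := by
  rw [← h.pd_metric_const hy, ← h.pd_metric_const hy]
  refine pd_congr ?_ u
  filter_upwards [h.eventually_mem hy] with z hz using h.symm z hz v w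

theorem metric_lc (u v w : R4) : G y (lc G u y v) w =
    (1 / 2) * (pd u G y v w + pd v G y u w - pd w G y u v) := by
  obtain ⟨E, hE⟩ := h.exists_isFrame hy
  exact hE.metric_sharp (J := 0) (h.symm y hy)
    { toFun := fun w ↦
        (1 / 2) * (pd u G y v w + pd v G y u w - pd w G y u v)
      map_add' := fun a b ↦ by simp only [map_add, add_apply, pd_add_dir]; ring
      map_smul' := fun a b ↦ by
        simp only [map_smul, smul_apply, smul_eq_mul, pd_smul_dir, RingHom.id_apply]; ring } w

theorem christoffel_eq (u v : R4) : (ofFields G J).christoffel y u v = lc G u y v := by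
  have hp := h.pd_metric_const hy
  rw [christoffel, lc_apply]
  simp only [ofFields, hp]
  rfl

theorem lc_symm (u v : R4) : lc G u y v = lc G v y u := by
  refine h.ext_metric hy fun w ↦ ?_
  rw [h.metric_lc hy, h.metric_lc hy, h.pd_metric_symm hy w u v]
  ring

theorem pd_metric_apply (u v w : R4) :
    pd u G y v w = G y (lc G u y v) w + G y v (lc G u y w) := by
  rw [h.symm y hy v, h.metric_lc hy, h.metric_lc hy, h.pd_metric_symm hy u w v]
  ring

/-- Metric compatibility of the Levi-Civita connection. -/
theorem pd_metric {X Y : R4 → R4} (hX : DifferentiableAt ℝ X y) (hY : DifferentiableAt ℝ Y y)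
    (u : R4) : pd u (fun z ↦ G z (X z) (Y z)) y =
      G y (pd u X y + lc G u y (X y)) (Y y) + G y (X y) (pd u Y y + lc G u y (Y y)) := by
  have hd := differentiableAt_of_smooth (h.contDiffAt_G hy)
  rw [pd_clm_apply (A := fun z ↦ G z (X z)) (hd.clm_apply hX) hY, pd_clm_apply hd hX]
  simp only [add_apply, map_add, h.pd_metric_apply hy]
  ring

/-- Cramer's rule: the entries of the inverse are quotients of polynomials in the metric
coefficients, with nonzero determinant in the denominator. -/
theorem contDiffAt_ginv (i j : Fin 4) : ContDiffAt ℝ ∞ (fun z ↦ (ofFields G 0).ginv z i j) y := by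
  obtain ⟨E, hE⟩ := h.exists_isFrame hy
  have hdet : ∀ (A : R4 → Matrix (Fin 4) (Fin 4) ℝ),
      (∀ k l, ContDiffAt ℝ ∞ (fun z ↦ A z k l) y) → ContDiffAt ℝ ∞ (fun z ↦ (A z).det) y :=
    fun A hA ↦ by
      simp only [Matrix.det_apply]
      exact ContDiffAt.sum fun σ _ ↦ (contDiffAt_prod fun k _ ↦ hA _ _).const_smul _
  have hent : ∀ k l, ContDiffAt ℝ ∞ (fun z ↦ G z (basisVec k) (basisVec l)) y := fun k l ↦
    ((h.contDiffAt_G hy).clm_apply contDiffAt_const).clm_apply contDiffAt_const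
  simp only [ginv, Matrix.inv_def, Ring.inverse_eq_inv', Matrix.smul_apply, smul_eq_mul,
    Matrix.adjugate_apply]
  refine ContDiffAt.mul (ContDiffAt.inv (hdet _ hent) hE.det_ne_zero) (hdet _ fun k l ↦ ?_)
  by_cases hk : k = j
  · subst hk
    simpa using contDiffAt_const
  · simp only [Matrix.updateRow_ne hk]
    exact hent k l

theorem contDiffAt_lc (u : R4) : ContDiffAt ℝ ∞ (lc G u) y := by
  have hop := h.isOpen
  refine ContDiffOn.contDiffAt (s := U) ?_ (hop.mem_nhds hy)
  rw [contDiffOn_clm_apply]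
  intro v z hz
  refine ContDiffAt.contDiffWithinAt ?_
  have hG' : ∀ a b c, ContDiffAt ℝ ∞ (fun z ↦ pd a G z b c) z := fun a b c ↦ by
    refine (contDiffAt_pd (f := fun z ↦ G z b c) (((h.contDiffAt_G hz).clm_apply
      contDiffAt_const).clm_apply contDiffAt_const) a).congr_of_eventuallyEq ?_
    filter_upwards [h.eventually_mem hz] with t ht using (h.pd_metric_const ht a b c).symm
  simp only [lc_apply, sharp]
  refine ContDiffAt.sum fun i _ ↦ ContDiffAt.sum fun j _ ↦
    ContDiffAt.fun_smul ?_ contDiffAt_const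
  exact (h.contDiffAt_ginv hz i j).mul
    (contDiffAt_const.mul (((hG' _ _ _).add (hG' _ _ _)).sub (hG' _ _ _)))

/-! ### Curvature -/

theorem pd_lc_apply (u v w : R4) : pd u (fun z ↦ lc G v z w) y = pd u (lc G v) y w :=
  pd_clm_apply_const (differentiableAt_of_smooth (h.contDiffAt_lc hy v)) u w

/-- The minus sign reflects the convention R_{X,Y} = ∇_{[X,Y]} - [∇_X, ∇_Y], opposite to that of
`curvEnd`. -/
theorem curvOp_eq (u v w : R4) :
    (ofFields G J).curvOp y u v w = -curvEnd (lc G) u v y w := by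
  have hp : ∀ u v, pd u (fun z ↦ (ofFields G J).christoffel z v w) y = pd u (lc G v) y w := by
    intro u v
    rw [← h.pd_lc_apply hy]
    refine pd_congr ?_ u
    filter_upwards [h.eventually_mem hy] with z hz using h.christoffel_eq hz v w
  simp only [curvOp, hp, h.christoffel_eq hy, curvEnd, sub_apply, add_apply,
    mul_apply_eq_comp]
  abel

theorem curv_eq (u v w z : R4) :
    (ofFields G J).curv y u v w z = -G y (curvEnd (lc G) u v y w) z := by
  rw [curv, h.curvOp_eq hy]
  simp [ofFields]

/-- Expanding the second partials of g(w, z) by metric compatibility and using that they commute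
leaves exactly the skewness of the curvature. -/
theorem curvEnd_skew (u v w z : R4) :
    G y (curvEnd (lc G) u v y w) z = -G y w (curvEnd (lc G) u v y z) := by
  have dlc : ∀ u w, DifferentiableAt ℝ (fun z ↦ lc G u z w) y := fun u w ↦
    (differentiableAt_of_smooth (h.contDiffAt_lc hy u)).clm_apply (differentiableAt_const w)
  have hpp : ∀ u v, pd u (pd v fun t ↦ G t w z) y =
      G y (pd u (lc G v) y w + lc G u y (lc G v y w)) z + G y (lc G v y w) (lc G u y z)
      + (G y (lc G u y w) (lc G v y z) + G y w (pd u (lc G v) y z + lc G u y (lc G v y z))) := by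
    intro u v
    have he : (pd v fun t ↦ G t w z) =ᶠ[nhds y]
        fun t ↦ G t (lc G v t w) z + G t w (lc G v t z) := by
      filter_upwards [h.eventually_mem hy] with t ht
      rw [h.pd_metric_const ht, h.pd_metric_apply ht]
    have hd := differentiableAt_of_smooth (h.contDiffAt_G hy)
    rw [pd_congr he, pd_add ((hd.clm_apply (dlc v w)).clm_apply (differentiableAt_const z))
      ((hd.clm_apply (differentiableAt_const w)).clm_apply (dlc v z)),
      h.pd_metric hy (dlc v w) (differentiableAt_const z),
      h.pd_metric hy (differentiableAt_const w) (dlc v z), h.pd_lc_apply hy, h.pd_lc_apply hy,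
      pd_const, pd_const, zero_add, zero_add]
  have hc := pd_comm (f := fun t ↦ G t w z)
    (((h.contDiffAt_G hy).clm_apply contDiffAt_const).clm_apply contDiffAt_const) u v
  rw [hpp, hpp] at hc
  simp only [curvEnd, sub_apply, add_apply, mul_apply_eq_comp, map_add, map_sub]
    at hc ⊢
  linarith

theorem curvEnd_bianchi (u v w : R4) : curvEnd (lc G) u v y w + curvEnd (lc G) v w y u
    + curvEnd (lc G) w u y v = 0 := by
  have hp : ∀ u v w, pd u (lc G v) y w = pd u (lc G w) y v := fun u v w ↦ by
    rw [← h.pd_lc_apply hy, ← h.pd_lc_apply hy]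
    refine pd_congr ?_ u
    filter_upwards [h.eventually_mem hy] with t ht using h.lc_symm ht v w
  simp only [curvEnd, sub_apply, add_apply, mul_apply_eq_comp]
  rw [hp u v w, hp v u w, hp w v u, h.lc_symm hy v w, h.lc_symm hy u w, h.lc_symm hy u v]
  abel

omit h hy in
theorem curvEnd_antisymm (u v : R4) : curvEnd (lc G) u v y = -curvEnd (lc G) v u y := by
  simp only [curvEnd]; abel

theorem curvEnd_add (u u' v : R4) : curvEnd (lc G) (u + u') v y =
    curvEnd (lc G) u v y + curvEnd (lc G) u' v y := by
  have d := fun u ↦ differentiableAt_of_smooth (h.contDiffAt_lc hy u)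
  simp only [curvEnd, lc_add, pd_add (d u) (d u'), pd_add_dir]
  ext1 w
  simp only [sub_apply, add_apply, mul_apply_eq_comp, map_add]
  abel

theorem curvEnd_smul (r : ℝ) (u v : R4) : curvEnd (lc G) (r • u) v y =
    r • curvEnd (lc G) u v y := by
  have d := fun u ↦ differentiableAt_of_smooth (h.contDiffAt_lc hy u)
  have hp : pd v (fun y ↦ r • lc G u y) y = r • pd v (lc G u) y := by
    simp [pd, fderiv_fun_const_smul (d u)]
  simp only [curvEnd, lc_smul, pd_smul_dir, hp]
  ext1 w
  simp only [sub_apply, add_apply, mul_apply_eq_comp, smul_apply, map_smul]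
  module

end IsAlmostHermitianOn
end

noncomputable section

/-! ### The covariant derivative of the almost complex structure -/

namespace Coord

/-- The covariant derivative `∇_u J`. -/
def nablaJ (G : R4 → R4 →L[ℝ] R4 →L[ℝ] ℝ) (J : R4 → R4 →L[ℝ] R4) (u : R4) :
    R4 → R4 →L[ℝ] R4 :=
  Connection.covD (lc G) u J

/-- The components `∇²_{w,u} J` of the second covariant derivative. -/
def nablaSqJ (G : R4 → R4 →L[ℝ] R4 →L[ℝ] ℝ) (J : R4 → R4 →L[ℝ] R4) (w u y : R4) :
    R4 →L[ℝ] R4 :=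
  Connection.covD (lc G) w (nablaJ G J u) y - nablaJ G J (lc G w y u) y

section

variable {G : R4 → R4 →L[ℝ] R4 →L[ℝ] ℝ} {y : R4} {E : Fin 4 → R4}

theorem covD_add_dir (A : R4 → R4 →L[ℝ] R4) (u u' z : R4) :
    Connection.covD (lc G) (u + u') A z
      = Connection.covD (lc G) u A z + Connection.covD (lc G) u' A z := by
  simp only [Connection.covD, lc_add, pd_add_dir]
  ext1 v
  simp only [sub_apply, add_apply, mul_apply_eq_comp, map_add]
  abel

theorem covD_smul_dir (A : R4 → R4 →L[ℝ] R4) (r : ℝ) (u z : R4) :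
    Connection.covD (lc G) (r • u) A z = r • Connection.covD (lc G) u A z := by
  simp only [Connection.covD, lc_smul, pd_smul_dir]
  ext1 v
  simp only [sub_apply, add_apply, smul_apply, mul_apply_eq_comp, map_smul]
  module

theorem IsFrame.parseval (hE : IsFrame (G y) E) (a b : R4) :
    ∑ l, G y a (E l) * G y b (E l) = G y a b := by
  conv_rhs => rw [hE.eq_sum b]
  simp [mul_comm]

theorem IsFrame.trEnd_eq (hE : IsFrame (G y) E) (A : R4 →L[ℝ] R4) :
    Connection.trEnd A = ∑ k, G y (A (E k)) (E k) := by
  rw [Connection.trEnd_eq_sum]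
  exact hE.trace_eq (A : R4 →ₗ[ℝ] R4)

theorem IsFrame.inner2_eq {J : R4 → R4 →L[ℝ] R4} (hE : IsFrame (G y) E)
    {α β : R4 → R4 → ℝ} (hα : IsBilin α) (hβ : IsBilin β) :
    (ofFields G J).inner2 y α β = (1 / 2) * ∑ k, ∑ l, α (E k) (E l) * β (E k) (E l) := by
  have h1 : ∀ u u', (ofFields G J).tr y (fun v v' ↦ α u v * β u' v')
      = ∑ l, α u (E l) * β u' (E l) := fun u u' ↦ hE.tr_eq (T := fun v v' ↦ α u v * β u' v')
    ⟨fun _ _ _ ↦ by rw [hα.add_right]; ring, fun _ _ _ ↦ by rw [hα.smul_right]; ring,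
      fun _ _ _ ↦ by rw [hβ.add_right]; ring, fun _ _ _ ↦ by rw [hβ.smul_right]; ring⟩
  rw [inner2]
  simp only [h1]
  rw [hE.tr_eq (T := fun u u' ↦ ∑ l, α u (E l) * β u' (E l))]
  constructor <;> intros <;>
    simp only [hα.add_left, hα.smul_left, hβ.add_left, hβ.smul_left, Finset.mul_sum,
      ← Finset.sum_add_distrib] <;>
    exact Finset.sum_congr rfl fun _ _ ↦ by ring

end

end Coord

namespace IsAlmostHermitianOn

open Coord Connection

variable {U : Set R4} {G : R4 → R4 →L[ℝ] R4 →L[ℝ] ℝ} {J : R4 → R4 →L[ℝ] R4}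
  (h : IsAlmostHermitianOn U G J) {y : R4} (hy : y ∈ U) {E : Fin 4 → R4}

include h hy

theorem eventually_contDiffAt_J : ∀ᶠ z in nhds y, ContDiffAt ℝ ∞ J z := by
  filter_upwards [h.eventually_mem hy] with z hz using h.contDiffAt_J hz

theorem eventually_J_mul_J : ∀ᶠ z in nhds y, J z * J z = -1 := by
  filter_upwards [h.eventually_mem hy] with z hz using h.J_mul_J hz

theorem contDiffAt_nablaJ (u : R4) : ContDiffAt ℝ ∞ (nablaJ G J u) y :=
  contDiffAt_covD (h.contDiffAt_lc hy) (h.contDiffAt_J hy) u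

/-- The covariant derivative of a skew field of endomorphisms is skew. -/
theorem covD_skew {A : R4 → R4 →L[ℝ] R4} (hA : DifferentiableAt ℝ A y)
    (hs : ∀ z ∈ U, ∀ a b, G z (A z a) b = -G z a (A z b)) (u a b : R4) :
    G y (covD (lc G) u A y a) b = -G y a (covD (lc G) u A y b) := by
  have hAc : ∀ a, DifferentiableAt ℝ (fun z ↦ A z a) y := fun a ↦
    hA.clm_apply (differentiableAt_const a)
  have hd := differentiableAt_of_smooth (h.contDiffAt_G hy)
  have he : (fun z ↦ G z (A z a) b + G z a (A z b)) =ᶠ[nhds y] fun _ ↦ 0 := by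
    filter_upwards [h.eventually_mem hy] with z hz
    rw [hs z hz, neg_add_cancel]
  have h1 := pd_congr he u
  rw [pd_add ((hd.clm_apply (hAc a)).clm_apply (differentiableAt_const b))
      ((hd.clm_apply (differentiableAt_const a)).clm_apply (hAc b)),
    h.pd_metric hy (hAc a) (differentiableAt_const b),
    h.pd_metric hy (differentiableAt_const a) (hAc b), pd_const, pd_const, pd_const,
    pd_clm_apply_const hA, pd_clm_apply_const hA] at h1
  have h2 := hs y hy (lc G u y a) b
  have h3 := hs y hy a (lc G u y b)
  simp only [covD, sub_apply, add_apply, mul_apply_eq_comp, map_add, map_sub, zero_add] at h1 ⊢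
  linarith

theorem nablaJ_skew (u a b : R4) : G y (nablaJ G J u y a) b = -G y a (nablaJ G J u y b) :=
  h.covD_skew hy (differentiableAt_of_smooth (h.contDiffAt_J hy)) (fun _ hz ↦ h.J_skew hz) u a b

theorem nablaJ_anticomm (u a : R4) : nablaJ G J u y (J y a) = -J y (nablaJ G J u y a) :=
  DFunLike.congr_fun (covD_anticomm (Γ := lc G)
    (differentiableAt_of_smooth (h.contDiffAt_J hy)) (h.eventually_J_mul_J hy) u) a

theorem pd_J_apply (u v : R4) : pd u (fun z ↦ J z v) y =
    nablaJ G J u y v - lc G u y (J y v) + J y (lc G u y v) := by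
  rw [pd_clm_apply_const (differentiableAt_of_smooth (h.contDiffAt_J hy))]
  simp only [nablaJ, covD, sub_apply, add_apply, mul_apply_eq_comp]
  abel

theorem nabla2_omega (u v w : R4) : (ofFields G J).nabla2 y (ofFields G J).omega u v w
    = G y (nablaJ G J u y v) w := by
  have dJ : DifferentiableAt ℝ (fun z ↦ J z v) y :=
    (differentiableAt_of_smooth (h.contDiffAt_J hy)).clm_apply (differentiableAt_const v)
  have ho : ∀ z a b, (ofFields G J).omega z a b = G z (J z a) b := fun _ _ _ ↦ rfl
  simp only [nabla2, ho, h.christoffel_eq hy]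
  rw [h.pd_metric hy dJ (differentiableAt_const w), h.pd_J_apply hy, pd_const]
  simp only [map_add, map_sub, add_apply, sub_apply, zero_add]
  ring

/-- The connection has no torsion, so brackets may be computed with ∇: the Christoffel terms cancel
in pairs and only ∇J survives. -/
theorem nij_eq (u v : R4) : (ofFields G J).nij y u v =
    nablaJ G J (J y u) y v - nablaJ G J (J y v) y u - J y (nablaJ G J u y v)
      + J y (nablaJ G J v y u) := by
  have hJ : ∀ z a, (ofFields G J).J z a = J z a := fun _ _ ↦ rfl
  have hp : ∀ a b, fderiv ℝ (fun z ↦ J z a) y b =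
    nablaJ G J b y a - lc G b y (J y a) + J y (lc G b y a) := fun a b ↦ h.pd_J_apply hy b a
  simp only [nij, VectorField.lieBracket, hJ, hp, fderiv_fun_const, Pi.zero_apply, zero_apply,
    map_sub, map_add, map_zero, h.J_sq y hy]
  rw [h.lc_symm hy (J y v) (J y u), h.lc_symm hy u (J y v), h.lc_symm hy v (J y u),
    h.lc_symm hy u v]
  abel

theorem rhoStar_eq (u v : R4) : (ofFields G J).rhoStar y u v =
    (1 / 2) * trEnd (J y * curvEnd (lc G) u v y) := by
  obtain ⟨E, hE⟩ := h.exists_isFrame hy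
  have ho : ∀ a b, (ofFields G J).omega y a b = G y (J y a) b := fun _ _ ↦ rfl
  rw [rhoStar, hE.inner2_eq, hE.trEnd_eq]
  · simp only [ho, h.curv_eq hy, neg_mul, Finset.sum_neg_distrib, hE.parseval,
      mul_apply_eq_comp]
    simp only [h.J_skew hy, Finset.sum_neg_distrib]
  · constructor <;> intros <;> simp only [h.curv_eq hy, map_add, map_smul, add_apply, smul_apply,
      smul_eq_mul] <;> ring
  · constructor <;> intros <;> simp only [ho, map_add, map_smul, add_apply, smul_apply,
      smul_eq_mul]

theorem Phi_eq (u v : R4) : (ofFields G J).Phi y u v =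
    (1 / 4) * trEnd (J y * (nablaJ G J v y * nablaJ G J u y)) := by
  obtain ⟨E, hE⟩ := h.exists_isFrame hy
  have hJ : ∀ z a, (ofFields G J).J z a = J z a := fun _ _ ↦ rfl
  rw [Phi, hE.inner2_eq, trEnd_mul_comm, hE.trEnd_eq]
  · simp only [hJ, h.nabla2_omega hy, neg_mul, Finset.sum_neg_distrib, hE.parseval,
      mul_apply_eq_comp]
    simp only [h.nablaJ_skew hy v (nablaJ G J u y _), Finset.sum_neg_distrib]
    ring
  · constructor <;> intros <;> simp only [hJ, h.nabla2_omega hy, map_add, map_smul, add_apply,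
      smul_apply, smul_eq_mul] <;> ring
  · constructor <;> intros <;> simp only [h.nabla2_omega hy, map_add, map_smul, add_apply,
      smul_apply, smul_eq_mul]

theorem lee_eq_frame (hE : IsFrame (G y) E) (v : R4) : (ofFields G J).lee y v =
    -∑ k, G y (nablaJ G J (E k) y (J y v)) (E k) := by
  have hJ : ∀ z a, (ofFields G J).J z a = J z a := fun _ _ ↦ rfl
  rw [lee, Jform, delta2, hE.tr_eq]
  · simp only [hJ, h.nabla2_omega hy, neg_neg, h.nablaJ_skew hy _ (E _), Finset.sum_neg_distrib,
      h.symm y hy (E _)]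
  · constructor <;> intros <;> simp only [hJ, h.nabla2_omega hy, nablaJ, covD_add_dir,
      covD_smul_dir, map_add, map_smul, add_apply, smul_apply, smul_eq_mul]

/-- An orthonormal frame is available only at a single point. Rewriting the trace in the fixed
coordinate basis gives a formula that can be differentiated. -/
theorem lee_eq (v : R4) : (ofFields G J).lee y v =
    -∑ i, nablaJ G J (basisVec i) y (J y v) i := by
  obtain ⟨E, hE⟩ := h.exists_isFrame hy
  rw [h.lee_eq_frame hy hE]
  congr 1
  exact (hE.trace_eq
    { toFun := fun u ↦ nablaJ G J u y (J y v)
      map_add' := fun a b ↦ by simp only [nablaJ, covD_add_dir, add_apply]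
      map_smul' := fun a b ↦ by
        simp only [nablaJ, covD_smul_dir, smul_apply, RingHom.id_apply] }).symm

end IsAlmostHermitianOn
end

noncomputable section

/-! ### Consequences of the first Gray identity -/

namespace IsAlmostHermitianOn

open Coord Connection

variable {U : Set R4} {G : R4 → R4 →L[ℝ] R4 →L[ℝ] ℝ} {J : R4 → R4 →L[ℝ] R4}
  (h : IsAlmostHermitianOn U G J) {y : R4} (hy : y ∈ U) {E : Fin 4 → R4}

include h hy

/-- The Gray identity on the pair (a, Jb) gives g(Fa, Jb) = -g(FJa, b); skewness of J turns this
into FJ = JF. -/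
theorem curvEnd_comm_J (hA : ∀ y ∈ U, ∀ u v w z, (ofFields G J).curv y u v w z
      = (ofFields G J).curv y u v (J y w) (J y z)) (u v : R4) :
    curvEnd (lc G) u v y * J y = J y * curvEnd (lc G) u v y := by
  ext1 a
  refine h.ext_metric hy fun b ↦ ?_
  have h1 := hA y hy u v a (J y b)
  rw [h.curv_eq hy, h.curv_eq hy, h.J_sq y hy] at h1
  have h2 := h.J_skew hy (curvEnd (lc G) u v y a) b
  simp only [mul_apply_eq_comp, map_neg] at h1 ⊢
  linarith

theorem covD_nablaJ_symm (hF : ∀ y ∈ U, ∀ u v,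
      curvEnd (lc G) u v y * J y = J y * curvEnd (lc G) u v y) (u v : R4) :
    covD (lc G) u (nablaJ G J v) y = covD (lc G) v (nablaJ G J u) y :=
  covD_covD_symm (h.contDiffAt_lc hy) (h.contDiffAt_J hy) u v (hF y hy u v)

theorem sum_comm_curvEnd_nablaJ (hF : ∀ y ∈ U, ∀ u v,
      curvEnd (lc G) u v y * J y = J y * curvEnd (lc G) u v y) (u v w a : R4) :
    (curvEnd (lc G) u v y (nablaJ G J w y a) - nablaJ G J w y (curvEnd (lc G) u v y a))
      + (curvEnd (lc G) v w y (nablaJ G J u y a) - nablaJ G J u y (curvEnd (lc G) v w y a))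
      + (curvEnd (lc G) w u y (nablaJ G J v y a) - nablaJ G J v y (curvEnd (lc G) w u y a))
      = 0 := by
  have h1 : ∀ u, ∀ᶠ z in nhds y, ContDiffAt ℝ ∞ (lc G u) z := fun u ↦ by
    filter_upwards [h.eventually_mem hy] with z hz using h.contDiffAt_lc hz u
  have h2 : ∀ u v, ∀ᶠ z in nhds y,
      covD (lc G) u (covD (lc G) v J) z = covD (lc G) v (covD (lc G) u J) z := fun u v ↦ by
    filter_upwards [h.eventually_mem hy] with z hz using h.covD_nablaJ_symm hz hF u v
  have h3 := congrArg (fun A : R4 →L[ℝ] R4 ↦ A a)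
    (sum_comm_curvEnd_covD h1 (h.eventually_contDiffAt_J hy) h2 u v w)
  simp only [add_apply, sub_apply, mul_apply_eq_comp] at h3
  unfold nablaJ
  refine Eq.trans ?_ (h3.trans ?_)
  · with_reducible rfl
  · with_reducible_and_instances rfl

theorem extd_rhoStar (hF : ∀ y ∈ U, ∀ u v,
      curvEnd (lc G) u v y * J y = J y * curvEnd (lc G) u v y) (u v w : R4) :
    extd (ofFields G J).rhoStar y u v w = 0 := by
  have h0 := extd_trace_curvEnd trEnd_mul_comm (h.contDiffAt_lc hy) (h.contDiffAt_J hy)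
    (h.eventually_J_mul_J hy) (hF y hy) u v w
  have hp : ∀ u v w, pd w (fun z ↦ (ofFields G J).rhoStar z u v) y
      = (1 / 2) * pd w (fun z ↦ trEnd (J z * curvEnd (lc G) u v z)) y := fun u v w ↦ by
    have d : DifferentiableAt ℝ (fun z ↦ trEnd (J z * curvEnd (lc G) u v z)) y :=
      trEnd.differentiableAt.comp y (differentiableAt_of_smooth
      ((h.contDiffAt_J hy).mul (contDiffAt_curvEnd (h.contDiffAt_lc hy) u v)))
    rw [← pd_const_mul d]
    refine pd_congr ?_ w
    filter_upwards [h.eventually_mem hy] with z hz using h.rhoStar_eq hz u v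
  simp only [extd] at h0
  simp only [extd, hp]
  linarith

theorem extd_Phi (hF : ∀ y ∈ U, ∀ u v,
      curvEnd (lc G) u v y * J y = J y * curvEnd (lc G) u v y) (u v w : R4) :
    extd (ofFields G J).Phi y u v w = 0 := by
  have h0 := extd_trace_covD trEnd_mul_comm (h.contDiffAt_lc hy) (h.eventually_contDiffAt_J hy)
    (h.eventually_J_mul_J hy) (h.covD_nablaJ_symm hy hF) u v w
  have hp : ∀ u v w, pd w (fun z ↦ (ofFields G J).Phi z u v) y
      = (1 / 4) * pd w (fun z ↦ trEnd (J z * (nablaJ G J v z * nablaJ G J u z))) y :=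
    fun u v w ↦ by
    have d : DifferentiableAt ℝ (fun z ↦ trEnd (J z * (nablaJ G J v z * nablaJ G J u z))) y :=
      trEnd.differentiableAt.comp y (differentiableAt_of_smooth
      ((h.contDiffAt_J hy).mul ((h.contDiffAt_nablaJ hy v).mul (h.contDiffAt_nablaJ hy u))))
    rw [← pd_const_mul d]
    refine pd_congr ?_ w
    filter_upwards [h.eventually_mem hy] with z hz using h.Phi_eq hz u v
  simp only [extd] at h0
  simp only [extd, hp, nablaJ]
  linarith

/-! ### The codifferential of the Lee form -/

omit h hy in
theorem nablaJ_add (u u' z : R4) : nablaJ G J (u + u') z = nablaJ G J u z + nablaJ G J u' z :=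
  covD_add_dir J u u' z

omit h hy in
theorem nablaJ_smul (r : ℝ) (u z : R4) : nablaJ G J (r • u) z = r • nablaJ G J u z :=
  covD_smul_dir J r u z

theorem covD_nablaJ_add (w u u' : R4) : covD (lc G) w (nablaJ G J (u + u')) y =
    covD (lc G) w (nablaJ G J u) y + covD (lc G) w (nablaJ G J u') y := by
  rw [funext (nablaJ_add u u')]
  exact covD_add (differentiableAt_of_smooth (h.contDiffAt_nablaJ hy u))
    (differentiableAt_of_smooth (h.contDiffAt_nablaJ hy u')) w

theorem covD_nablaJ_smul (w : R4) (r : ℝ) (u : R4) : covD (lc G) w (nablaJ G J (r • u)) y =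
    r • covD (lc G) w (nablaJ G J u) y := by
  have d := differentiableAt_of_smooth (h.contDiffAt_nablaJ hy u)
  have hp : pd w (fun z ↦ r • nablaJ G J u z) y = r • pd w (nablaJ G J u) y := by
    simp [pd, fderiv_fun_const_smul d]
  rw [funext (nablaJ_smul r u)]
  simp only [covD, hp]
  ext1 a
  simp only [sub_apply, add_apply, smul_apply, mul_apply_eq_comp, map_smul]
  module

/-- Closedness of K for the exterior covariant derivative, corrected by the Christoffel term in the
direction index, which is symmetric as there is no torsion. -/
theorem nablaSqJ_symm (hF : ∀ y ∈ U, ∀ u v,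
      curvEnd (lc G) u v y * J y = J y * curvEnd (lc G) u v y) (w u : R4) :
    nablaSqJ G J w u y = nablaSqJ G J u w y := by
  rw [nablaSqJ, nablaSqJ, h.covD_nablaJ_symm hy hF w u, h.lc_symm hy w u]

theorem nablaSqJ_skew (w u a b : R4) :
    G y (nablaSqJ G J w u y a) b = -G y a (nablaSqJ G J w u y b) := by
  have h1 := h.covD_skew hy (differentiableAt_of_smooth (h.contDiffAt_nablaJ hy u))
    (fun z hz ↦ h.nablaJ_skew hz u) w a b
  have h2 := h.nablaJ_skew hy (lc G w y u) a b
  simp only [nablaSqJ, sub_apply, map_sub]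
  linarith

theorem nablaSqJ_J (w u a : R4) : nablaSqJ G J w u y (J y a) = -J y (nablaSqJ G J w u y a)
    - nablaJ G J u y (nablaJ G J w y a) - nablaJ G J w y (nablaJ G J u y a) := by
  have h1 := DFunLike.congr_fun (covD_covD_anticomm (h.contDiffAt_lc hy)
    (h.eventually_contDiffAt_J hy) (h.eventually_J_mul_J hy) u w) a
  have h2 := h.nablaJ_anticomm hy (lc G w y u) a
  have h3 : J y (covD (lc G) w (nablaJ G J u) y a) + covD (lc G) w (nablaJ G J u) y (J y a)
      = -(nablaJ G J u y (nablaJ G J w y a)) - nablaJ G J w y (nablaJ G J u y a) := h1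
  simp only [nablaSqJ, sub_apply, map_sub, h2]
  rw [← eq_sub_iff_add_eq'] at h3
  rw [h3]
  abel

theorem nabla1_lee (hE : IsFrame (G y) E) (w v : R4) :
    (ofFields G J).nabla1 y (ofFields G J).lee w v =
      -∑ k, G y (nablaSqJ G J w (E k) y (J y v) + nablaJ G J (E k) y (nablaJ G J w y v)) (E k) := by
  have dJ := differentiableAt_of_smooth (h.contDiffAt_J hy)
  have dK := fun u ↦ differentiableAt_of_smooth (h.contDiffAt_nablaJ hy u)
  have hp : pd w (fun z ↦ (ofFields G J).lee z v) y =
      -∑ i, (pd w (fun z ↦ nablaJ G J (basisVec i) z * J z) y v) i := by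
    have he : (fun z ↦ (ofFields G J).lee z v) =ᶠ[nhds y]
        fun z ↦ -∑ i, EuclideanSpace.proj (𝕜 := ℝ) i ((nablaJ G J (basisVec i) z * J z) v) := by
      filter_upwards [h.eventually_mem hy] with z hz
      rw [h.lee_eq hz]
      simp
    have di : ∀ i : Fin 4, DifferentiableAt ℝ
        (fun z ↦ (nablaJ G J (basisVec i) z * J z) v) y := fun i ↦
      ((dK _).fun_mul dJ).clm_apply (differentiableAt_const v)
    have dpi : ∀ i : Fin 4, DifferentiableAt ℝ (fun z ↦ EuclideanSpace.proj (𝕜 := ℝ) i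
        ((nablaJ G J (basisVec i) z * J z) v)) y := fun i ↦
      (ContinuousLinearMap.differentiableAt _).comp y (di i)
    rw [pd_congr he, pd, fderiv_fun_neg, fderiv_fun_sum fun i _ ↦ dpi i]
    simp only [neg_apply, sum_apply]
    congr 1
    refine Finset.sum_congr rfl fun i _ ↦ ?_
    refine (pd_clm (EuclideanSpace.proj (𝕜 := ℝ) i) (di i) w).trans ?_
    rw [pd_clm_apply_const ((dK _).fun_mul dJ)]
    rfl
  have hq : ∀ u, pd w (fun z ↦ nablaJ G J u z * J z) y v =
      covD (lc G) w (nablaJ G J u) y (J y v) - lc G w y (nablaJ G J u y (J y v))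
        + nablaJ G J u y (nablaJ G J w y v) + nablaJ G J u y (J y (lc G w y v)) := fun u ↦ by
    rw [pd_mul (dK u) dJ]
    have e1 : nablaJ G J w y = pd w J y + lc G w y * J y - J y * lc G w y := rfl
    simp only [covD, e1, sub_apply, add_apply, mul_apply_eq_comp, map_add, map_sub]
    abel
  have hlee := h.lee_eq hy (lc G w y v)
  have ht := hE.trace_eq
    { toFun := fun u ↦ covD (lc G) w (nablaJ G J u) y (J y v)
        - lc G w y (nablaJ G J u y (J y v)) + nablaJ G J u y (nablaJ G J w y v)
      map_add' := fun a b ↦ by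
        simp only [h.covD_nablaJ_add hy, nablaJ_add, add_apply, map_add]; abel
      map_smul' := fun r a ↦ by
        simp only [h.covD_nablaJ_smul hy, nablaJ_smul, smul_apply, map_smul, RingHom.id_apply]
        module }
  let L : R4 →ₗ[ℝ] R4 :=
    { toFun := fun u ↦ nablaJ G J u y (J y v)
      map_add' := fun a b ↦ by simp only [nablaJ_add, add_apply]
      map_smul' := fun r a ↦ by simp only [nablaJ_smul, smul_apply, RingHom.id_apply] }
  -- Cyclicity of the trace for `lc G w y` and u ↦ (∇_u J)(Jv): it trades the Christoffel term on
  -- the value for the one on the direction index, as `nablaSqJ` requires.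
  have htr : ∑ k, G y (lc G w y (nablaJ G J (E k) y (J y v))) (E k)
      = ∑ k, G y (nablaJ G J (lc G w y (E k)) y (J y v)) (E k) := by
    have e1 := hE.trace_eq ((lc G w y : R4 →ₗ[ℝ] R4) * L)
    have e2 := hE.trace_eq (L * (lc G w y : R4 →ₗ[ℝ] R4))
    have e3 := trEnd_mul_comm (lc G w y) (LinearMap.toContinuousLinearMap L)
    rw [trEnd_eq_sum, trEnd_eq_sum] at e3
    exact e1.symm.trans (e3.trans e2)
  simp only [LinearMap.coe_mk, AddHom.coe_mk, map_add, map_sub, add_apply, sub_apply,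
    Finset.sum_add_distrib, Finset.sum_sub_distrib, PiLp.add_apply, PiLp.sub_apply] at ht
  rw [nabla1, h.christoffel_eq hy, hp, hlee]
  simp only [hq, nablaSqJ, map_add, map_sub, add_apply, sub_apply, Finset.sum_add_distrib,
    Finset.sum_sub_distrib, PiLp.add_apply, PiLp.sub_apply]
  linarith

/-- The second-order part of δθ is a trace T of ∇²J composed with J. Symmetry in the two directions,
skewness and the second derivative of J² = -1 together show that T is minus itself plus terms
quadratic in ∇J, hence T is itself quadratic. -/
theorem delta1_lee (hF : ∀ y ∈ U, ∀ u v,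
      curvEnd (lc G) u v y * J y = J y * curvEnd (lc G) u v y) (hE : IsFrame (G y) E) :
    (ofFields G J).delta1 y (ofFields G J).lee = (1 / 2) * ∑ l, ∑ k,
      G y (nablaJ G J (E k) y (nablaJ G J (E l) y (E l))
        - nablaJ G J (E l) y (nablaJ G J (E k) y (E l))) (E k) := by
  have hS : ∀ a b u, nablaSqJ G J (a + b) u y = nablaSqJ G J a u y + nablaSqJ G J b u y := by
    intro a b u
    rw [h.nablaSqJ_symm hy hF, h.nablaSqJ_symm hy hF a, h.nablaSqJ_symm hy hF b]
    simp only [nablaSqJ, h.covD_nablaJ_add hy, map_add, nablaJ_add]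
    abel
  have hS' : ∀ (r : ℝ) a u, nablaSqJ G J (r • a) u y = r • nablaSqJ G J a u y := by
    intro r a u
    rw [h.nablaSqJ_symm hy hF, h.nablaSqJ_symm hy hF a]
    simp only [nablaSqJ, h.covD_nablaJ_smul hy, map_smul, nablaJ_smul, smul_sub]
  rw [delta1, hE.tr_eq]
  · have hT : ∑ l, ∑ k, G y (nablaSqJ G J (E l) (E k) y (J y (E l))) (E k)
        = -∑ l, ∑ k, G y (nablaSqJ G J (E l) (E k) y (J y (E l))) (E k)
          - ∑ l, ∑ k, G y (nablaJ G J (E k) y (nablaJ G J (E l) y (E l))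
            + nablaJ G J (E l) y (nablaJ G J (E k) y (E l))) (E k) := by
      conv_lhs => rw [Finset.sum_comm]
      rw [← Finset.sum_neg_distrib, ← Finset.sum_sub_distrib]
      refine Finset.sum_congr rfl fun l _ ↦ ?_
      rw [← Finset.sum_neg_distrib, ← Finset.sum_sub_distrib]
      refine Finset.sum_congr rfl fun k _ ↦ ?_
      rw [h.nablaSqJ_symm hy hF, h.nablaSqJ_skew hy, h.J_skew hy, neg_neg, h.symm y hy,
        h.nablaSqJ_J hy]
      simp only [map_neg, map_sub, map_add, neg_apply, sub_apply, add_apply]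
      ring
    simp only [h.nabla1_lee hy hE, map_add, map_sub, add_apply, sub_apply,
      Finset.sum_add_distrib, Finset.sum_sub_distrib, Finset.sum_neg_distrib] at hT ⊢
    linarith
  · constructor <;> intros <;> simp only [h.nabla1_lee hy hE, hS, hS', nablaJ_add, nablaJ_smul,
      map_add, map_smul, add_apply, smul_apply, smul_eq_mul, ← Finset.sum_neg_distrib,
      Finset.mul_sum, ← Finset.sum_add_distrib] <;>
      exact Finset.sum_congr rfl fun _ _ ↦ by ring

end IsAlmostHermitianOn
end

noncomputable section

/-! ### The Ricci tensor -/

/-- The pair symmetry of algebraic curvature tensors. -/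
theorem pair_symm_of_bianchi {V : Type*} {R : V → V → V → V → ℝ}
    (h12 : ∀ u v w z, R u v w z = -R v u w z) (h34 : ∀ u v w z, R u v w z = -R u v z w)
    (hb : ∀ u v w z, R u v w z + R v w u z + R w u v z = 0) (u v w z : V) :
    R u v w z = R w z u v := by
  linarith [hb u v w z, hb v w z u, hb w z u v, hb z u v w, h12 w z u v, h34 u v w z,
    h12 v w u z, h34 v w u z, h12 w u v z, h34 w u v z, h34 v w z u, h12 z v w u, h34 z v w u,
    h12 w z v u, h34 w z v u, h12 z u w v, h34 z u w v, h12 u w z v, h34 u w z v,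
    h34 w z u v, h12 z v u w, h34 z u v w, h12 u v z w, h34 v z u w, h12 v z u w,
    h12 u v w z, h34 v z w u, h34 u w v z, h12 u w v z, h34 z v u w]

namespace Coord

theorem IsAdaptedFrame.sum_J {B : R4 →L[ℝ] R4 →L[ℝ] ℝ} {J : R4 →L[ℝ] R4} {E : Fin 4 → R4}
    (hE : IsAdaptedFrame B J E) {T : R4 → R4 → ℝ} (hT : IsBilin T) :
    ∑ k, T (J (E k)) (J (E k)) = ∑ k, T (E k) (E k) := by
  have hn : ∀ a, T (-a) (-a) = T a a := fun a ↦ by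
    rw [← neg_one_smul ℝ a, hT.smul_left, hT.smul_right]; ring
  simp only [Fin.sum_univ_four, hE.J_zero, hE.J_one, hE.J_two, hE.J_three, hn]
  ring

end Coord

namespace IsAlmostHermitianOn

open Coord Connection

variable {U : Set R4} {G : R4 → R4 →L[ℝ] R4 →L[ℝ] ℝ} {J : R4 → R4 →L[ℝ] R4}
  (h : IsAlmostHermitianOn U G J) {y : R4} (hy : y ∈ U) {E : Fin 4 → R4}

include h hy

theorem curvEnd_pair_symm (u v w z : R4) :
    G y (curvEnd (lc G) u v y w) z = G y (curvEnd (lc G) w z y u) v := by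
  refine pair_symm_of_bianchi (R := fun u v w z ↦ G y (curvEnd (lc G) u v y w) z) ?_ ?_ ?_ u v w z
  · intro u v w z
    rw [curvEnd_antisymm u v]
    simp
  · intro u v w z
    rw [h.curvEnd_skew hy, h.symm y hy]
  · intro u v w z
    have := congrArg (fun a ↦ G y a z) (h.curvEnd_bianchi hy u v w)
    simpa using this

theorem curvEnd_add_right (u v v' : R4) : curvEnd (lc G) u (v + v') y =
    curvEnd (lc G) u v y + curvEnd (lc G) u v' y := by
  rw [curvEnd_antisymm, h.curvEnd_add hy, curvEnd_antisymm v u, curvEnd_antisymm v' u]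
  abel

theorem curvEnd_smul_right (r : ℝ) (u v : R4) : curvEnd (lc G) u (r • v) y =
    r • curvEnd (lc G) u v y := by
  rw [curvEnd_antisymm, h.curvEnd_smul hy, curvEnd_antisymm v u, smul_neg, neg_neg]

theorem ricci_eq_sum (hE : IsFrame (G y) E) (u v : R4) : (ofFields G J).ricci y u v =
    -∑ k, G y (curvEnd (lc G) u (E k) y v) (E k) := by
  rw [ricci, hE.tr_eq]
  · simp only [h.curv_eq hy, Finset.sum_neg_distrib]
  · constructor <;> intros <;> simp only [h.curv_eq hy, h.curvEnd_add_right hy,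
      h.curvEnd_smul_right hy, map_add, map_smul, add_apply, smul_apply, smul_eq_mul] <;> ring

theorem ricci_symm (u v : R4) : (ofFields G J).ricci y u v = (ofFields G J).ricci y v u := by
  obtain ⟨E, hE⟩ := h.exists_isFrame hy
  rw [h.ricci_eq_sum hy hE, h.ricci_eq_sum hy hE]
  simp only [h.curvEnd_pair_symm hy u]

theorem isBilin_ricci : IsBilin ((ofFields G J).ricci y) := by
  obtain ⟨E, hE⟩ := h.exists_isFrame hy
  constructor <;> intros <;> simp only [h.ricci_eq_sum hy hE, h.curvEnd_add hy, h.curvEnd_smul hy,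
    map_add, map_smul, add_apply, smul_apply, smul_eq_mul, Finset.sum_add_distrib,
    ← Finset.mul_sum] <;> ring

theorem curvEnd_J_J (hF : ∀ u v, curvEnd (lc G) u v y * J y = J y * curvEnd (lc G) u v y)
    (u v w z : R4) :
    G y (curvEnd (lc G) u v y (J y w)) (J y z) = G y (curvEnd (lc G) u v y w) z := by
  have h1 : curvEnd (lc G) u v y (J y w) = J y (curvEnd (lc G) u v y w) :=
    DFunLike.congr_fun (hF u v) w
  rw [h1, h.J_orth y hy]

/-- Curvature is J-invariant in its last pair of arguments, hence by pair symmetry also in its first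
pair. Tracing over the frame Je_k instead of e_k gives the result. -/
theorem ricci_J_J (hF : ∀ u v, curvEnd (lc G) u v y * J y = J y * curvEnd (lc G) u v y)
    (u v : R4) :
    (ofFields G J).ricci y (J y u) (J y v) = (ofFields G J).ricci y u v := by
  obtain ⟨E, hE, -⟩ := h.exists_isAdaptedFrame_smul hy (a := basisVec 0) (by simp [basisVec])
  rw [h.ricci_eq_sum hy hE.isFrame, h.ricci_eq_sum hy hE.isFrame]
  rw [← hE.sum_J (T := fun a b ↦ G y (curvEnd (lc G) (J y u) a y (J y v)) b)]
  · congr 1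
    refine Finset.sum_congr rfl fun k _ ↦ ?_
    rw [h.curvEnd_J_J hy hF, h.curvEnd_pair_symm hy, h.curvEnd_J_J hy hF, h.curvEnd_pair_symm hy]
  · constructor <;> intros <;> simp only [h.curvEnd_add_right hy, h.curvEnd_smul_right hy, map_add,
      map_smul, add_apply, smul_apply, smul_eq_mul]

theorem ricci_J_left (hF : ∀ u v, curvEnd (lc G) u v y * J y = J y * curvEnd (lc G) u v y)
    (u v : R4) :
    (ofFields G J).ricci y (J y u) v = -(ofFields G J).ricci y u (J y v) := by
  rw [← h.ricci_J_J hy hF u (J y v), h.J_sq y hy, ← neg_one_smul ℝ v,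
    (h.isBilin_ricci hy).smul_right]
  ring

theorem rho_eq (hF : ∀ u v, curvEnd (lc G) u v y * J y = J y * curvEnd (lc G) u v y)
    (u v : R4) : (ofFields G J).rho y u v = (ofFields G J).ricci y (J y u) v := by
  have hJ : ∀ z a, (ofFields G J).J z a = J z a := fun _ _ ↦ rfl
  rw [rho, hJ, hJ, hJ, h.ricci_J_J hy hF]
  ring

theorem rhoStar_eq_sum (hE : IsFrame (G y) E) (u v : R4) : (ofFields G J).rhoStar y u v =
    -(1 / 2) * ∑ k, G y (curvEnd (lc G) u v y (E k)) (J y (E k)) := by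
  rw [h.rhoStar_eq hy, hE.trEnd_eq]
  simp only [mul_apply_eq_comp, h.J_skew hy, Finset.sum_neg_distrib]
  ring

/-- The first Bianchi identity on (u, v, e_k), paired with Je_k and summed, writes ρ* through two
Ricci contractions, once J has been moved onto the vector argument. -/
theorem rhoStar_eq_rho (hF : ∀ u v, curvEnd (lc G) u v y * J y = J y * curvEnd (lc G) u v y)
    (u v : R4) : (ofFields G J).rhoStar y u v = (ofFields G J).rho y u v := by
  obtain ⟨E, hE⟩ := h.exists_isFrame hy
  have h1 : ∀ u v k, G y (curvEnd (lc G) u (E k) y v) (J y (E k))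
      = -G y (curvEnd (lc G) u (E k) y (J y v)) (E k) := fun u v k ↦ by
    rw [← h.curvEnd_J_J hy hF, h.J_sq y hy, map_neg]
  have h2 : ∀ k, G y (curvEnd (lc G) u v y (E k)) (J y (E k))
      = G y (curvEnd (lc G) v (E k) y (J y u)) (E k)
        - G y (curvEnd (lc G) u (E k) y (J y v)) (E k) := fun k ↦ by
    have hb := congrArg (fun a ↦ G y a (J y (E k))) (h.curvEnd_bianchi hy u v (E k))
    have h3 := h1 u v k
    have h4 := h1 v u k
    rw [curvEnd_antisymm (E k) u] at hb
    simp only [map_add, map_zero, map_neg, add_apply, neg_apply, zero_apply] at hb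
    linarith
  rw [h.rhoStar_eq_sum hy hE, h.rho_eq hy hF, h.ricci_symm hy]
  have h5 := h.ricci_eq_sum hy hE v (J y u)
  have h6 := h.ricci_eq_sum hy hE u (J y v)
  have h7 := h.ricci_J_left hy hF u v
  have h8 := h.ricci_symm hy (J y u) v
  simp only [h2, Finset.sum_sub_distrib]
  linarith

end IsAlmostHermitianOn
end

noncomputable section

/-! ### Components in an adapted frame -/

namespace Coord

/-- The component `g((∇_u J) e₀, e₂)` of `∇J` in an adapted frame. -/
def nablaJRe (G : R4 → R4 →L[ℝ] R4 →L[ℝ] ℝ) (J : R4 → R4 →L[ℝ] R4) (E : Fin 4 → R4) (y u : R4) :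
    ℝ := G y (nablaJ G J u y (E 0)) (E 2)

/-- The component `g((∇_u J) e₀, e₃)` of `∇J` in an adapted frame. -/
def nablaJIm (G : R4 → R4 →L[ℝ] R4 →L[ℝ] ℝ) (J : R4 → R4 →L[ℝ] R4) (E : Fin 4 → R4) (y u : R4) :
    ℝ := G y (nablaJ G J u y (E 0)) (E 3)

end Coord

namespace IsAlmostHermitianOn

open Coord Connection

variable {U : Set R4} {G : R4 → R4 →L[ℝ] R4 →L[ℝ] ℝ} {J : R4 → R4 →L[ℝ] R4}
  (h : IsAlmostHermitianOn U G J) {y : R4} (hy : y ∈ U) {E : Fin 4 → R4}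

include h hy

theorem metric_nablaJ_self (u a : R4) : G y (nablaJ G J u y a) a = 0 := by
  have := h.nablaJ_skew hy u a a
  rw [h.symm y hy a] at this
  linarith

theorem metric_nablaJ_J_self (u a : R4) : G y (nablaJ G J u y a) (J y a) = 0 := by
  have e1 := h.nablaJ_skew hy u a (J y a)
  rw [h.nablaJ_anticomm hy, map_neg, neg_neg] at e1
  have e2 := h.J_skew hy a (nablaJ G J u y a)
  rw [h.symm y hy (J y a)] at e2
  linarith

/-- Skewness and anticommutation with J make (∇_u J)a orthogonal to a and Ja. The same two
properties then determine ∇_u J on the whole frame from its value on e₀. -/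
theorem nablaJ_frame_zero (hE : IsAdaptedFrame (G y) (J y) E) (u : R4) :
    nablaJ G J u y (E 0) = nablaJRe G J E y u • E 2 + nablaJIm G J E y u • E 3 := by
  have h0 := h.metric_nablaJ_self hy u (E 0)
  have h1 := h.metric_nablaJ_J_self hy u (E 0)
  rw [hE.J_zero] at h1
  rw [hE.isFrame.eq_sum (nablaJ G J u y (E 0))]
  simp [Fin.sum_univ_four, h0, h1, nablaJRe, nablaJIm]

theorem nablaJ_frame_one (hE : IsAdaptedFrame (G y) (J y) E) (u : R4) :
    nablaJ G J u y (E 1) = nablaJIm G J E y u • E 2 - nablaJRe G J E y u • E 3 := by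
  rw [← hE.J_zero, h.nablaJ_anticomm hy, h.nablaJ_frame_zero hy hE]
  simp only [map_add, map_smul, hE.J_two, hE.J_three]
  module

theorem nablaJ_frame_two (hE : IsAdaptedFrame (G y) (J y) E) (u : R4) :
    nablaJ G J u y (E 2) = -(nablaJRe G J E y u • E 0) - nablaJIm G J E y u • E 1 := by
  have o : ∀ i j, G y (E i) (E j) = if i = j then (1 : ℝ) else 0 := hE.isFrame
  have h0 := h.metric_nablaJ_self hy u (E 2)
  have h1 := h.metric_nablaJ_J_self hy u (E 2)
  have h2 := h.nablaJ_skew hy u (E 2) (E 0)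
  have h3 := h.nablaJ_skew hy u (E 2) (E 1)
  rw [hE.J_two] at h1
  rw [h.nablaJ_frame_zero hy hE] at h2
  rw [h.nablaJ_frame_one hy hE] at h3
  simp [o] at h2 h3
  rw [hE.isFrame.eq_sum (nablaJ G J u y (E 2))]
  simp only [Fin.sum_univ_four, h0, h1, h2, h3]
  module

theorem nablaJ_frame_three (hE : IsAdaptedFrame (G y) (J y) E) (u : R4) :
    nablaJ G J u y (E 3) = nablaJRe G J E y u • E 1 - nablaJIm G J E y u • E 0 := by
  rw [← hE.J_two, h.nablaJ_anticomm hy, h.nablaJ_frame_two hy hE]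
  simp only [map_sub, map_neg, map_smul, hE.J_zero, hE.J_one]
  module

omit h hy in
theorem nablaJRe_add (u v : R4) :
    nablaJRe G J E y (u + v) = nablaJRe G J E y u + nablaJRe G J E y v := by
  simp only [nablaJRe, nablaJ_add, add_apply, map_add]

omit h hy in
theorem nablaJIm_add (u v : R4) :
    nablaJIm G J E y (u + v) = nablaJIm G J E y u + nablaJIm G J E y v := by
  simp only [nablaJIm, nablaJ_add, add_apply, map_add]

omit h hy in
theorem nablaJRe_smul (r : ℝ) (u : R4) :
    nablaJRe G J E y (r • u) = r * nablaJRe G J E y u := by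
  simp only [nablaJRe, nablaJ_smul, smul_apply, map_smul, smul_eq_mul]

omit h hy in
theorem nablaJIm_smul (r : ℝ) (u : R4) :
    nablaJIm G J E y (r • u) = r * nablaJIm G J E y u := by
  simp only [nablaJIm, nablaJ_smul, smul_apply, map_smul, smul_eq_mul]

omit h hy in
theorem nablaJRe_eq_sum (hE : IsFrame (G y) E) (u : R4) :
    nablaJRe G J E y u = ∑ k, G y u (E k) * nablaJRe G J E y (E k) := by
  conv_lhs => rw [hE.eq_sum u]
  simp only [Fin.sum_univ_four, nablaJRe_add, nablaJRe_smul]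

omit h hy in
theorem nablaJIm_eq_sum (hE : IsFrame (G y) E) (u : R4) :
    nablaJIm G J E y u = ∑ k, G y u (E k) * nablaJIm G J E y (E k) := by
  conv_lhs => rw [hE.eq_sum u]
  simp only [Fin.sum_univ_four, nablaJIm_add, nablaJIm_smul]

theorem nablaJ_eq_zero (hE : IsAdaptedFrame (G y) (J y) E) (u : R4)
    (hm : nablaJRe G J E y u = 0) (hn : nablaJIm G J E y u = 0) : nablaJ G J u y = 0 := by
  ext1 a
  rw [hE.isFrame.eq_sum a]
  simp [Fin.sum_univ_four, h.nablaJ_frame_zero hy hE, h.nablaJ_frame_one hy hE,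
    h.nablaJ_frame_two hy hE, h.nablaJ_frame_three hy hE, hm, hn]

/-- Φ is the wedge product of the two real components of ∇J, so anything whose wedge with either
component vanishes also has zero wedge with Φ. -/
theorem Phi_frame (hE : IsAdaptedFrame (G y) (J y) E) (u v : R4) :
    (ofFields G J).Phi y u v = nablaJRe G J E y u * nablaJIm G J E y v
      - nablaJRe G J E y v * nablaJIm G J E y u := by
  have o : ∀ i j, G y (E i) (E j) = if i = j then (1 : ℝ) else 0 := hE.isFrame
  rw [h.Phi_eq hy, hE.isFrame.trEnd_eq]
  simp only [mul_apply_eq_comp, h.J_skew hy, h.nablaJ_skew hy v, Fin.sum_univ_four, hE.J_zero,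
    hE.J_one, hE.J_two, hE.J_three, h.nablaJ_frame_zero hy hE, h.nablaJ_frame_one hy hE,
    h.nablaJ_frame_two hy hE, h.nablaJ_frame_three hy hE, map_add, map_sub, map_neg, map_smul,
    add_apply, sub_apply, neg_apply, smul_apply, smul_eq_mul, o]
  simp
  ring

theorem lee_frame (hE : IsAdaptedFrame (G y) (J y) E) :
    (ofFields G J).lee y (E 0) = nablaJRe G J E y (E 3) - nablaJIm G J E y (E 2) ∧
    (ofFields G J).lee y (E 1) = nablaJRe G J E y (E 2) + nablaJIm G J E y (E 3) ∧
    (ofFields G J).lee y (E 2) = nablaJIm G J E y (E 0) - nablaJRe G J E y (E 1) ∧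
    (ofFields G J).lee y (E 3) = -nablaJRe G J E y (E 0) - nablaJIm G J E y (E 1) := by
  have o : ∀ i j, G y (E i) (E j) = if i = j then (1 : ℝ) else 0 := hE.isFrame
  simp only [h.lee_eq_frame hy hE.isFrame, Fin.sum_univ_four, hE.J_zero,
    hE.J_one, hE.J_two, hE.J_three, h.nablaJ_frame_zero hy hE, h.nablaJ_frame_one hy hE,
    h.nablaJ_frame_two hy hE, h.nablaJ_frame_three hy hE, map_add, map_sub, map_neg, map_smul,
    add_apply, sub_apply, neg_apply, smul_apply, smul_eq_mul, o]
  refine ⟨?_, ?_, ?_, ?_⟩ <;> simp <;> ring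

/-- Up to the factor -2, this is the contraction Φ(e₀, e₁) + Φ(e₂, e₃) of Φ with ω. -/
theorem delta1_lee_frame (hF : ∀ y ∈ U, ∀ u v,
      curvEnd (lc G) u v y * J y = J y * curvEnd (lc G) u v y)
    (hE : IsAdaptedFrame (G y) (J y) E) :
    (ofFields G J).delta1 y (ofFields G J).lee =
      -2 * (nablaJRe G J E y (E 0) * nablaJIm G J E y (E 1)
        - nablaJRe G J E y (E 1) * nablaJIm G J E y (E 0)
        + nablaJRe G J E y (E 2) * nablaJIm G J E y (E 3)
        - nablaJRe G J E y (E 3) * nablaJIm G J E y (E 2)) := by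
  have o : ∀ i j, G y (E i) (E j) = if i = j then (1 : ℝ) else 0 := hE.isFrame
  rw [h.delta1_lee hy hF hE.isFrame]
  simp only [map_sub, sub_apply, h.nablaJ_skew hy _ (nablaJ G J _ y _)]
  simp only [Fin.sum_univ_four, h.nablaJ_frame_zero hy hE, h.nablaJ_frame_one hy hE,
    h.nablaJ_frame_two hy hE, h.nablaJ_frame_three hy hE, map_add, map_sub, map_neg, map_smul,
    add_apply, sub_apply, neg_apply, smul_apply, smul_eq_mul, o]
  simp
  ring

/-- The wedge product of the star-Ricci form with `∇J` vanishes. -/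
theorem rhoStar_wedge_nablaJ (hF : ∀ y ∈ U, ∀ u v,
      curvEnd (lc G) u v y * J y = J y * curvEnd (lc G) u v y)
    (hE : IsAdaptedFrame (G y) (J y) E) (u v w : R4) :
    ((ofFields G J).rhoStar y u v * nablaJRe G J E y w
      + (ofFields G J).rhoStar y v w * nablaJRe G J E y u
      + (ofFields G J).rhoStar y w u * nablaJRe G J E y v = 0) ∧
    ((ofFields G J).rhoStar y u v * nablaJIm G J E y w
      + (ofFields G J).rhoStar y v w * nablaJIm G J E y u
      + (ofFields G J).rhoStar y w u * nablaJIm G J E y v = 0) := by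
  have hs : ∀ u v a, G y (curvEnd (lc G) u v y a) a = 0 := fun u v a ↦ by
    have := h.curvEnd_skew hy u v a a
    rw [h.symm y hy a] at this
    linarith
  have hr : ∀ u v, (ofFields G J).rhoStar y u v = -G y (curvEnd (lc G) u v y (E 0)) (E 1)
      - G y (curvEnd (lc G) u v y (E 2)) (E 3) := fun u v ↦ by
    rw [h.rhoStar_eq_sum hy hE.isFrame]
    simp only [Fin.sum_univ_four, hE.J_zero, hE.J_one, hE.J_two, hE.J_three, map_neg]
    have e1 := h.curvEnd_skew hy u v (E 1) (E 0)
    have e2 := h.curvEnd_skew hy u v (E 3) (E 2)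
    rw [h.symm y hy (E 1)] at e1
    rw [h.symm y hy (E 3)] at e2
    linarith
  -- The component along e₂ of [F, K]e₀ involves the skew F only through g(Fe₀, e₁) + g(Fe₂, e₃) =
  -- -ρ*. Together with the component along e₃ below, F rotates the pair of components of K by ρ*.
  have h2 : ∀ u v w, G y (curvEnd (lc G) u v y (nablaJ G J w y (E 0))
      - nablaJ G J w y (curvEnd (lc G) u v y (E 0))) (E 2)
      = (ofFields G J).rhoStar y u v * nablaJIm G J E y w := fun u v w ↦ by
    have e2 := h.curvEnd_skew hy u v (E 3) (E 2)
    rw [h.symm y hy (E 3)] at e2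
    rw [map_sub, sub_apply, h.nablaJ_skew hy w _ (E 2), h.nablaJ_frame_zero hy hE,
      h.nablaJ_frame_two hy hE, hr]
    simp only [map_add, map_sub, map_neg, map_smul, add_apply, smul_apply, smul_eq_mul, hs, e2]
    ring
  have h3 : ∀ u v w, G y (curvEnd (lc G) u v y (nablaJ G J w y (E 0))
      - nablaJ G J w y (curvEnd (lc G) u v y (E 0))) (E 3)
      = -((ofFields G J).rhoStar y u v * nablaJRe G J E y w) := fun u v w ↦ by
    rw [map_sub, sub_apply, h.nablaJ_skew hy w _ (E 3), h.nablaJ_frame_zero hy hE,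
      h.nablaJ_frame_three hy hE, hr]
    simp only [map_add, map_sub, map_smul, add_apply, smul_apply, smul_eq_mul, hs]
    ring
  have hc := h.sum_comm_curvEnd_nablaJ hy hF u v w (E 0)
  constructor
  · have := congrArg (fun a ↦ G y a (E 3)) hc
    simp only [map_add, add_apply, h3, map_zero, zero_apply] at this
    linarith
  · have := congrArg (fun a ↦ G y a (E 2)) hc
    simp only [map_add, add_apply, h2, map_zero, zero_apply] at this
    linarith

/-! ### The Nijenhuis tensor -/

theorem nij_J_left (u v : R4) :
    (ofFields G J).nij y (J y u) v = -J y ((ofFields G J).nij y u v) := by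
  rw [h.nij_eq hy, h.nij_eq hy]
  have hn : ∀ a, nablaJ G J (-a) y = -nablaJ G J a y := fun a ↦ by
    rw [← neg_one_smul ℝ a, nablaJ_smul]
    ext1 b
    simp
  simp only [h.J_sq y hy, hn, h.nablaJ_anticomm hy, map_add, map_sub, map_neg, neg_apply]
  abel

theorem nij_antisymm (u v : R4) : (ofFields G J).nij y u v = -(ofFields G J).nij y v u := by
  rw [h.nij_eq hy, h.nij_eq hy]
  abel

theorem nij_add_left (u u' v : R4) : (ofFields G J).nij y (u + u') v =
    (ofFields G J).nij y u v + (ofFields G J).nij y u' v := by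
  simp only [h.nij_eq hy, map_add, nablaJ_add, add_apply]
  abel

theorem nij_smul_left (r : ℝ) (u v : R4) : (ofFields G J).nij y (r • u) v =
    r • (ofFields G J).nij y u v := by
  simp only [h.nij_eq hy, map_smul, nablaJ_smul, smul_apply]
  module

theorem nij_add_right (u v v' : R4) : (ofFields G J).nij y u (v + v') =
    (ofFields G J).nij y u v + (ofFields G J).nij y u v' := by
  rw [h.nij_antisymm hy, h.nij_add_left hy, h.nij_antisymm hy v, h.nij_antisymm hy v']
  abel

theorem nij_smul_right (r : ℝ) (u v : R4) : (ofFields G J).nij y u (r • v) =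
    r • (ofFields G J).nij y u v := by
  rw [h.nij_antisymm hy, h.nij_smul_left hy, h.nij_antisymm hy v, smul_neg, neg_neg]

/-- N is antisymmetric and J-antilinear in each argument. In complex dimension 2 such a form is
determined by its value on e₀, e₂. -/
theorem nij_frame (hE : IsAdaptedFrame (G y) (J y) E) (u v : R4) :
    (ofFields G J).nij y u v =
      (G y u (E 0) * G y v (E 2) - G y u (E 2) * G y v (E 0)
        - G y u (E 1) * G y v (E 3) + G y u (E 3) * G y v (E 1)) • (ofFields G J).nij y (E 0) (E 2)
      - (G y u (E 1) * G y v (E 2) - G y u (E 2) * G y v (E 1)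
        + G y u (E 0) * G y v (E 3) - G y u (E 3) * G y v (E 0)) •
          J y ((ofFields G J).nij y (E 0) (E 2)) := by
  have hself : ∀ a, (ofFields G J).nij y a a = 0 := fun a ↦ by
    have h2 : (2 : ℝ) • (ofFields G J).nij y a a = 0 := by
      rw [two_smul, ← eq_neg_iff_add_eq_zero]
      exact h.nij_antisymm hy a a
    exact (smul_eq_zero.1 h2).resolve_left two_ne_zero
  have h12 : (ofFields G J).nij y (E 1) (E 2) = -J y ((ofFields G J).nij y (E 0) (E 2)) := by
    rw [← hE.J_zero, h.nij_J_left hy]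
  have h10 : (ofFields G J).nij y (E 1) (E 0) = 0 := by
    rw [← hE.J_zero, h.nij_J_left hy, hself, map_zero, neg_zero]
  have h32 : (ofFields G J).nij y (E 3) (E 2) = 0 := by
    rw [← hE.J_two, h.nij_J_left hy, hself, map_zero, neg_zero]
  have h30 : (ofFields G J).nij y (E 3) (E 0) = J y ((ofFields G J).nij y (E 0) (E 2)) := by
    rw [← hE.J_two, h.nij_J_left hy, h.nij_antisymm hy (E 2), map_neg, neg_neg]
  have h31 : (ofFields G J).nij y (E 3) (E 1) = (ofFields G J).nij y (E 0) (E 2) := by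
    rw [← hE.J_two, h.nij_J_left hy, h.nij_antisymm hy (E 2), h12, map_neg, map_neg,
      h.J_sq y hy]
    simp
  have hu := hE.isFrame.eq_sum u
  have hv := hE.isFrame.eq_sum v
  rw [Fin.sum_univ_four] at hu hv
  generalize G y u (E 0) = u0, G y u (E 1) = u1, G y u (E 2) = u2, G y u (E 3) = u3,
    G y v (E 0) = v0, G y v (E 1) = v1, G y v (E 2) = v2, G y v (E 3) = v3 at *
  rw [hu, hv]
  simp only [h.nij_add_left hy, h.nij_add_right hy, h.nij_smul_left hy, h.nij_smul_right hy,
    hself, h.nij_antisymm hy (E 0) (E 1), h.nij_antisymm hy (E 2) (E 1),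
    h.nij_antisymm hy (E 2) (E 0), h.nij_antisymm hy (E 2) (E 3), h.nij_antisymm hy (E 0) (E 3),
    h.nij_antisymm hy (E 1) (E 3), h12, h10, h32, h30, h31]
  module

theorem nij_frame_apply (hE : IsAdaptedFrame (G y) (J y) E) :
    (ofFields G J).nij y (E 0) (E 2) =
      -((nablaJRe G J E y (E 1) + nablaJIm G J E y (E 0)) • E 0)
      + (nablaJRe G J E y (E 0) - nablaJIm G J E y (E 1)) • E 1
      - (nablaJRe G J E y (E 3) + nablaJIm G J E y (E 2)) • E 2
      + (nablaJRe G J E y (E 2) - nablaJIm G J E y (E 3)) • E 3 := by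
  rw [h.nij_eq hy]
  simp only [hE.J_zero, hE.J_two, h.nablaJ_frame_zero hy hE, h.nablaJ_frame_two hy hE, map_add,
    map_sub, map_neg, map_smul, hE.J_one, hE.J_three]
  module

/-- Eight ordered pairs of frame vectors give ±N(e₀, e₂) or ±J N(e₀, e₂), all of the same length,
and the other pairs give zero; the factor 4 is half of eight. -/
theorem nijNormSq_frame (hE : IsAdaptedFrame (G y) (J y) E) :
    (ofFields G J).nijNormSq y =
      4 * G y ((ofFields G J).nij y (E 0) (E 2)) ((ofFields G J).nij y (E 0) (E 2)) := by
  have o : ∀ i j, G y (E i) (E j) = if i = j then (1 : ℝ) else 0 := hE.isFrame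
  have h1 : ∀ u u', (ofFields G J).tr y (fun v v' ↦
      (ofFields G J).g y ((ofFields G J).nij y u v) ((ofFields G J).nij y u' v'))
      = ∑ l, G y ((ofFields G J).nij y u (E l)) ((ofFields G J).nij y u' (E l)) := fun u u' ↦ by
    refine hE.isFrame.tr_eq (T := fun v v' ↦
      G y ((ofFields G J).nij y u v) ((ofFields G J).nij y u' v')) ?_
    constructor <;> intros <;> simp only [h.nij_add_right hy, h.nij_smul_right hy, map_add,
      map_smul, add_apply, smul_apply, smul_eq_mul]
  rw [nijNormSq]
  simp only [h1]
  rw [hE.isFrame.tr_eq]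
  · simp only [Fin.sum_univ_four]
    rw [h.nij_frame hy hE (E 0) (E 0), h.nij_frame hy hE (E 0) (E 1), h.nij_frame hy hE (E 0) (E 3),
      h.nij_frame hy hE (E 1) (E 0), h.nij_frame hy hE (E 1) (E 1), h.nij_frame hy hE (E 1) (E 2),
      h.nij_frame hy hE (E 1) (E 3), h.nij_frame hy hE (E 2) (E 0), h.nij_frame hy hE (E 2) (E 1),
      h.nij_frame hy hE (E 2) (E 2), h.nij_frame hy hE (E 2) (E 3), h.nij_frame hy hE (E 3) (E 0),
      h.nij_frame hy hE (E 3) (E 1), h.nij_frame hy hE (E 3) (E 2), h.nij_frame hy hE (E 3) (E 3)]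
    simp [o, h.J_orth y hy]
    ring
  · constructor <;> intros <;> simp only [h.nij_add_left hy, h.nij_smul_left hy, map_add,
      map_smul, add_apply, smul_apply, smul_eq_mul, Finset.sum_add_distrib, Finset.mul_sum]

end IsAlmostHermitianOn
end

noncomputable section

/-! ### The Ricci tensor, the Lee form and the Nijenhuis tensor -/

theorem eq_zero_of_sum_four_sq {a b c d : ℝ} (h : a ^ 2 + b ^ 2 + c ^ 2 + d ^ 2 = 0) :
    a = 0 ∧ b = 0 ∧ c = 0 ∧ d = 0 := by
  have ha := sq_nonneg a
  have hb := sq_nonneg b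
  have hc := sq_nonneg c
  have hd := sq_nonneg d
  refine ⟨?_, ?_, ?_, ?_⟩ <;> refine pow_eq_zero_iff two_ne_zero |>.1 ?_ <;> linarith

/-- If the 2-form `ρ` is annihilated by wedging with `m` and `n`, it is proportional
to `m ∧ n`. -/
theorem proportional_of_wedge_eq_zero {V : Type*} {ρ : V → V → ℝ} {m n : V → ℝ}
    (ha : ∀ u v, ρ u v = -ρ v u) (hm : ∀ u v w, ρ u v * m w + ρ v w * m u + ρ w u * m v = 0)
    (hn : ∀ u v w, ρ u v * n w + ρ v w * n u + ρ w u * n v = 0) (u v w z : V) :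
    (m u * n v - m v * n u) * ρ w z = (m w * n z - m z * n w) * ρ u v := by
  linear_combination n v * hm w z u - m w * hn z u v - m z * hn u w v + n u * hm v z w
    + m z * n w * ha u v - m v * n u * ha w z

/-- Associativity of the wedge product: ρ ∧ (m ∧ n) = (ρ ∧ m) ∧ n. -/
theorem wedge_wedge_eq_zero {ρ : R4 → R4 → ℝ} {m n : R4 → ℝ}
    (ha : ∀ u v, ρ u v = -ρ v u) (hm : ∀ u v w, ρ u v * m w + ρ v w * m u + ρ w u * m v = 0)
    (u v w z : R4) : Coord.wedge ρ (fun u v ↦ m u * n v - m v * n u) u v w z = 0 := by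
  simp only [Coord.wedge]
  linear_combination n z * hm u v w - n w * hm u v z + n v * hm u w z - n u * hm v w z
    - n z * m v * ha u w + n w * m v * ha u z - n v * m w * ha u z + n u * m w * ha v z

namespace IsAlmostHermitianOn

open Coord Connection

variable {U : Set R4} {G : R4 → R4 →L[ℝ] R4 →L[ℝ] ℝ} {J : R4 → R4 →L[ℝ] R4}
  (h : IsAlmostHermitianOn U G J) {y : R4} (hy : y ∈ U) {E : Fin 4 → R4}

include h hy

/-- A J-invariant symmetric form amounts to a Hermitian 2×2 matrix: two real diagonal entries and
one complex off-diagonal entry. -/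
theorem ricci_frame (hF : ∀ u v, curvEnd (lc G) u v y * J y = J y * curvEnd (lc G) u v y)
    (hE : IsAdaptedFrame (G y) (J y) E) (u v : R4) :
    (ofFields G J).ricci y u v =
      (ofFields G J).ricci y (E 0) (E 0) * (G y u (E 0) * G y v (E 0) + G y u (E 1) * G y v (E 1))
      + (ofFields G J).ricci y (E 2) (E 2)
        * (G y u (E 2) * G y v (E 2) + G y u (E 3) * G y v (E 3))
      + (ofFields G J).ricci y (E 0) (E 2)
        * (G y u (E 0) * G y v (E 2) + G y u (E 2) * G y v (E 0)
          + G y u (E 1) * G y v (E 3) + G y u (E 3) * G y v (E 1))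
      + (ofFields G J).ricci y (E 0) (E 3)
        * (G y u (E 0) * G y v (E 3) + G y u (E 3) * G y v (E 0)
          - G y u (E 1) * G y v (E 2) - G y u (E 2) * G y v (E 1)) := by
  have hb := h.isBilin_ricci hy
  have hs := h.ricci_symm hy
  have hJJ := h.ricci_J_J hy hF
  have hn : ∀ a b, (ofFields G J).ricci y a (-b) = -(ofFields G J).ricci y a b := fun a b ↦ by
    rw [← neg_one_smul ℝ b, hb.smul_right]; ring
  have h11 := hJJ (E 0) (E 0)
  have h33 := hJJ (E 2) (E 2)
  have h01 := hJJ (E 0) (E 1)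
  have h23 := hJJ (E 2) (E 3)
  have h13 := hJJ (E 0) (E 2)
  have h12 := hJJ (E 0) (E 3)
  rw [hE.J_zero] at h11 h01 h13 h12
  rw [hE.J_two] at h33 h23 h13
  rw [hE.J_one, hn] at h01
  rw [hE.J_three, hn] at h23 h12
  have h10 := hs (E 1) (E 0)
  have h32 := hs (E 3) (E 2)
  have h20 := hs (E 2) (E 0)
  have h30 := hs (E 3) (E 0)
  have h21 := hs (E 2) (E 1)
  have h31 := hs (E 3) (E 1)
  have k01 : (ofFields G J).ricci y (E 0) (E 1) = 0 := by linarith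
  have k23 : (ofFields G J).ricci y (E 2) (E 3) = 0 := by linarith
  have k12 : (ofFields G J).ricci y (E 1) (E 2) = -(ofFields G J).ricci y (E 0) (E 3) := by
    linarith
  have e := hb.eq_sum Finset.univ Finset.univ (fun k ↦ G y u (E k)) (fun k ↦ G y v (E k)) E E
  rw [← hE.isFrame.eq_sum, ← hE.isFrame.eq_sum] at e
  rw [e]
  simp only [Fin.sum_univ_four, h11, h33, h13, h10, h32, h20, h30, h21, h31, k01, k23, k12]
  ring

theorem scal_frame (hF : ∀ u v, curvEnd (lc G) u v y * J y = J y * curvEnd (lc G) u v y)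
    (hE : IsAdaptedFrame (G y) (J y) E) : (ofFields G J).scal y =
      2 * (ofFields G J).ricci y (E 0) (E 0) + 2 * (ofFields G J).ricci y (E 2) (E 2) := by
  have h11 := h.ricci_J_J hy hF (E 0) (E 0)
  have h33 := h.ricci_J_J hy hF (E 2) (E 2)
  rw [hE.J_zero] at h11
  rw [hE.J_two] at h33
  rw [scal, hE.isFrame.tr_eq (h.isBilin_ricci hy), Fin.sum_univ_four, h11, h33]
  ring

/-- The relations between the Ricci tensor and `∇J` in an adapted frame. -/
theorem ricci_relations (hF : ∀ y ∈ U, ∀ u v,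
      curvEnd (lc G) u v y * J y = J y * curvEnd (lc G) u v y)
    (hE : IsAdaptedFrame (G y) (J y) E) {f : R4 → ℝ}
    (hf : ∀ u v w, (ofFields G J).rhoStar y u v * f w + (ofFields G J).rhoStar y v w * f u
      + (ofFields G J).rhoStar y w u * f v = 0) :
    ((ofFields G J).ricci y (E 0) (E 0) * f (E 2) - (ofFields G J).ricci y (E 0) (E 2) * f (E 0)
      + (ofFields G J).ricci y (E 0) (E 3) * f (E 1) = 0) ∧
    ((ofFields G J).ricci y (E 0) (E 0) * f (E 3) - (ofFields G J).ricci y (E 0) (E 3) * f (E 0)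
      - (ofFields G J).ricci y (E 0) (E 2) * f (E 1) = 0) ∧
    ((ofFields G J).ricci y (E 2) (E 2) * f (E 0) - (ofFields G J).ricci y (E 0) (E 3) * f (E 3)
      - (ofFields G J).ricci y (E 0) (E 2) * f (E 2) = 0) ∧
    ((ofFields G J).ricci y (E 2) (E 2) * f (E 1) - (ofFields G J).ricci y (E 0) (E 2) * f (E 3)
      + (ofFields G J).ricci y (E 0) (E 3) * f (E 2) = 0) := by
  have o : ∀ i j, G y (E i) (E j) = if i = j then (1 : ℝ) else 0 := hE.isFrame
  have hr : ∀ u v, (ofFields G J).rhoStar y u v = (ofFields G J).ricci y (J y u) v := fun u v ↦ by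
    rw [h.rhoStar_eq_rho hy (hF y hy), h.rho_eq hy (hF y hy)]
  -- A 3-form in dimension 4 has four components, and each gives one relation.
  have c1 := hf (E 0) (E 1) (E 2)
  have c2 := hf (E 0) (E 1) (E 3)
  have c3 := hf (E 0) (E 2) (E 3)
  have c4 := hf (E 1) (E 2) (E 3)
  simp only [hr, hE.J_zero, hE.J_one, hE.J_two, hE.J_three] at c1 c2 c3 c4
  rw [h.ricci_frame hy (hF y hy) hE (E 1), h.ricci_frame hy (hF y hy) hE (-E 0),
    h.ricci_frame hy (hF y hy) hE (E 3)] at c1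
  rw [h.ricci_frame hy (hF y hy) hE (E 1), h.ricci_frame hy (hF y hy) hE (-E 0),
    h.ricci_frame hy (hF y hy) hE (-E 2)] at c2
  rw [h.ricci_frame hy (hF y hy) hE (E 1), h.ricci_frame hy (hF y hy) hE (E 3),
    h.ricci_frame hy (hF y hy) hE (-E 2)] at c3
  rw [h.ricci_frame hy (hF y hy) hE (-E 0), h.ricci_frame hy (hF y hy) hE (E 3),
    h.ricci_frame hy (hF y hy) hE (-E 2)] at c4
  simp only [map_neg, neg_apply, o] at c1 c2 c3 c4
  simp at c1 c2 c3 c4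
  refine ⟨?_, ?_, ?_, ?_⟩ <;> linarith

/-- The Lee form as a linear form. -/
theorem exists_lee_linear : ∃ θ : R4 →ₗ[ℝ] ℝ, (ofFields G J).lee y = θ := by
  obtain ⟨E, hE⟩ := h.exists_isFrame hy
  refine ⟨
    { toFun := (ofFields G J).lee y
      map_add' := fun a b ↦ ?_
      map_smul' := fun r a ↦ ?_ }, rfl⟩
  · simp only [h.lee_eq_frame hy hE, map_add, add_apply, Finset.sum_add_distrib]
    ring
  · simp only [h.lee_eq_frame hy hE, map_smul, smul_apply, smul_eq_mul, RingHom.id_apply,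
      ← Finset.mul_sum]
    ring

theorem metric_sharp_lee (w : R4) :
    G y ((ofFields G J).sharp y ((ofFields G J).lee y)) w = (ofFields G J).lee y w := by
  obtain ⟨E, hE⟩ := h.exists_isFrame hy
  obtain ⟨θ, hθ⟩ := h.exists_lee_linear hy
  rw [hθ, hE.metric_sharp (h.symm y hy)]

theorem sharp_Jform_lee : (ofFields G J).sharp y ((ofFields G J).Jform y ((ofFields G J).lee y)) =
    J y ((ofFields G J).sharp y ((ofFields G J).lee y)) := by
  obtain ⟨E, hE⟩ := h.exists_isFrame hy
  obtain ⟨θ, hθ⟩ := h.exists_lee_linear hy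
  refine h.ext_metric hy fun w ↦ ?_
  have e : (ofFields G J).Jform y ((ofFields G J).lee y) =
      ((-(θ.comp (J y : R4 →ₗ[ℝ] R4)) : R4 →ₗ[ℝ] ℝ) : R4 → ℝ) := by
    funext v
    rw [Jform, hθ]
    rfl
  rw [e, hE.metric_sharp (h.symm y hy), h.J_skew hy, h.metric_sharp_lee hy, hθ]
  rfl

/-! ### Eigenvectors of the Ricci tensor and points of zero scalar curvature. -/

theorem ricci_sharp_lee (hF : ∀ y ∈ U, ∀ u v,
      curvEnd (lc G) u v y * J y = J y * curvEnd (lc G) u v y) (v : R4) :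
    (ofFields G J).ricci y ((ofFields G J).sharp y ((ofFields G J).lee y)) v = 0 := by
  obtain ⟨E, hE, -⟩ := h.exists_isAdaptedFrame_smul hy (a := basisVec 0) (by simp [basisVec])
  obtain ⟨m1, m2, m3, m4⟩ := h.ricci_relations hy hF hE
    fun u v w ↦ (h.rhoStar_wedge_nablaJ hy hF hE u v w).1
  obtain ⟨n1, n2, n3, n4⟩ := h.ricci_relations hy hF hE
    fun u v w ↦ (h.rhoStar_wedge_nablaJ hy hF hE u v w).2
  obtain ⟨t0, t1, t2, t3⟩ := h.lee_frame hy hE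
  rw [h.ricci_frame hy (hF y hy) hE]
  simp only [h.metric_sharp_lee hy, t0, t1, t2, t3]
  -- Each component of θ is a sum or difference of one component of m and one of n, so each
  -- coefficient of Ric(θ) combines one relation for m with one for n.
  linear_combination G y v (E 0) * (m2 - n1) + G y v (E 1) * (m1 + n2)
    + G y v (E 2) * (n3 - m4) - G y v (E 3) * (m3 + n4)

/-- N(e₀, e₂) is built from the sums and differences complementary to those in θ. The relations then
say that Ric and its cofactor Hermitian matrix differ in the right way for the trace s/2 to appear
as eigenvalue. -/
theorem ricci_nij_frame (hF : ∀ y ∈ U, ∀ u v,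
      curvEnd (lc G) u v y * J y = J y * curvEnd (lc G) u v y)
    (hE : IsAdaptedFrame (G y) (J y) E) (v : R4) :
    (ofFields G J).ricci y ((ofFields G J).nij y (E 0) (E 2)) v =
      (ofFields G J).scal y / 2 * G y ((ofFields G J).nij y (E 0) (E 2)) v := by
  have o : ∀ i j, G y (E i) (E j) = if i = j then (1 : ℝ) else 0 := hE.isFrame
  obtain ⟨m1, m2, m3, m4⟩ := h.ricci_relations hy hF hE
    fun u v w ↦ (h.rhoStar_wedge_nablaJ hy hF hE u v w).1
  obtain ⟨n1, n2, n3, n4⟩ := h.ricci_relations hy hF hE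
    fun u v w ↦ (h.rhoStar_wedge_nablaJ hy hF hE u v w).2
  have hc : ∀ k, G y ((ofFields G J).nij y (E 0) (E 2)) (E k) =
      ![-(nablaJRe G J E y (E 1) + nablaJIm G J E y (E 0)),
        nablaJRe G J E y (E 0) - nablaJIm G J E y (E 1),
        -(nablaJRe G J E y (E 3) + nablaJIm G J E y (E 2)),
        nablaJRe G J E y (E 2) - nablaJIm G J E y (E 3)] k := fun k ↦ by
    rw [h.nij_frame_apply hy hE]
    simp only [map_add, map_sub, map_neg, map_smul, add_apply, sub_apply, neg_apply, smul_apply,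
      smul_eq_mul, o]
    fin_cases k <;> simp
  rw [h.ricci_frame hy (hF y hy) hE, h.scal_frame hy (hF y hy) hE,
    ← hE.isFrame.parseval (_ : R4) v]
  simp only [Fin.sum_univ_four, hc]
  simp
  linear_combination G y v (E 0) * (m4 + n3) + G y v (E 1) * (n4 - m3)
    + G y v (E 2) * (m2 + n1) + G y v (E 3) * (n2 - m1)

theorem ricci_J_nij_frame (hF : ∀ y ∈ U, ∀ u v,
      curvEnd (lc G) u v y * J y = J y * curvEnd (lc G) u v y)
    (hE : IsAdaptedFrame (G y) (J y) E) (v : R4) :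
    (ofFields G J).ricci y (J y ((ofFields G J).nij y (E 0) (E 2))) v =
      (ofFields G J).scal y / 2 * G y (J y ((ofFields G J).nij y (E 0) (E 2))) v := by
  rw [h.ricci_J_left hy (hF y hy), h.ricci_nij_frame hy hF hE, h.J_skew hy]
  ring

/-- `Ric = s/2` on the image of the Nijenhuis tensor. -/
theorem ricci_imN (hF : ∀ y ∈ U, ∀ u v,
      curvEnd (lc G) u v y * J y = J y * curvEnd (lc G) u v y) {X : R4}
    (hX : X ∈ (ofFields G J).imN y) (v : R4) :
    (ofFields G J).ricci y X v = (ofFields G J).scal y / 2 * G y X v := by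
  obtain ⟨E, hE, -⟩ := h.exists_isAdaptedFrame_smul hy (a := basisVec 0) (by simp [basisVec])
  have hb := h.isBilin_ricci hy
  have h0 : ∀ X, (ofFields G J).ricci y X v - (ofFields G J).scal y / 2 * G y X v =
      (LinearMap.mk₂ ℝ ((ofFields G J).ricci y) hb.add_left hb.smul_left hb.add_right
        hb.smul_right).flip v X - ((ofFields G J).scal y / 2) * (G y).flip v X := fun _ ↦ rfl
  rw [imN] at hX
  induction hX using Submodule.span_induction with
  | mem X hX =>
    obtain ⟨u, w, rfl⟩ := hX
    rw [h.nij_frame hy hE, sub_eq_add_neg, ← neg_smul, hb.add_left, hb.smul_left, hb.smul_left,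
      h.ricci_nij_frame hy hF hE, h.ricci_J_nij_frame hy hF hE]
    simp only [map_add, map_smul, add_apply, smul_apply, smul_eq_mul]
    ring
  | zero => rw [← sub_eq_zero, h0]; simp
  | add a b _ _ ha hb' => rw [hb.add_left, ha, hb']; simp; ring
  | smul r a _ ha => rw [hb.smul_left, ha]; simp; ring

omit h hy in
theorem ricci0_eq (u v : R4) : (ofFields G J).ricci0 y u v =
    (ofFields G J).ricci y u v - (ofFields G J).scal y / 4 * G y u v := rfl

theorem ricci0Form_lee (hF : ∀ y ∈ U, ∀ u v,
      curvEnd (lc G) u v y * J y = J y * curvEnd (lc G) u v y) :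
    (ofFields G J).ricci0Form y ((ofFields G J).lee y) =
      (-((ofFields G J).scal y / 4)) • (ofFields G J).lee y := by
  funext v
  rw [ricci0Form, ricci0_eq, h.ricci_sharp_lee hy hF, h.metric_sharp_lee hy]
  simp

theorem ricci0Form_Jform_lee (hF : ∀ y ∈ U, ∀ u v,
      curvEnd (lc G) u v y * J y = J y * curvEnd (lc G) u v y) :
    (ofFields G J).ricci0Form y ((ofFields G J).Jform y ((ofFields G J).lee y)) =
      (-((ofFields G J).scal y / 4)) • (ofFields G J).Jform y ((ofFields G J).lee y) := by
  funext v
  have hJ : ∀ z a, (ofFields G J).J z a = J z a := fun _ _ ↦ rfl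
  rw [ricci0Form, h.sharp_Jform_lee hy, ricci0_eq, h.ricci_J_left hy (hF y hy),
    h.ricci_sharp_lee hy hF, h.J_skew hy, h.metric_sharp_lee hy]
  simp [Jform, hJ]

/-- Eigenvectors of the symmetric tensor Ric for distinct eigenvalues are orthogonal: θ and Jθ have
eigenvalue 0, and Im N has eigenvalue s/2. -/
theorem metric_lee_imN (hF : ∀ y ∈ U, ∀ u v,
      curvEnd (lc G) u v y * J y = J y * curvEnd (lc G) u v y)
    (hs : (ofFields G J).scal y ≠ 0) {X Y : R4}
    (hX : X ∈ Submodule.span ℝ {(ofFields G J).sharp y ((ofFields G J).lee y),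
      (ofFields G J).sharp y ((ofFields G J).Jform y ((ofFields G J).lee y))})
    (hY : Y ∈ (ofFields G J).imN y) : G y X Y = 0 := by
  have hmul : ∀ Z, (ofFields G J).ricci y Z Y = 0 → G y Z Y = 0 := fun Z hZ ↦ by
    rw [h.ricci_symm hy, h.ricci_imN hy hF hY, h.symm y hy] at hZ
    exact (mul_eq_zero.1 hZ).resolve_left (by simpa using hs)
  obtain ⟨a, b, rfl⟩ := Submodule.mem_span_pair.1 hX
  have h1 := hmul _ (h.ricci_sharp_lee hy hF Y)
  have h2 := hmul (J y ((ofFields G J).sharp y ((ofFields G J).lee y)))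
    (by rw [h.ricci_J_left hy (hF y hy), h.ricci_sharp_lee hy hF, neg_zero])
  rw [h.sharp_Jform_lee hy]
  simp [h1, h2]

theorem ricci0Vec_imN (hF : ∀ y ∈ U, ∀ u v,
      curvEnd (lc G) u v y * J y = J y * curvEnd (lc G) u v y) {X : R4}
    (hX : X ∈ (ofFields G J).imN y) :
    (ofFields G J).ricci0Vec y X = ((ofFields G J).scal y / 4) • X := by
  obtain ⟨E, hE⟩ := h.exists_isFrame hy
  have e : (ofFields G J).ricci0 y X =
      ((((ofFields G J).scal y / 4) • (G y X : R4 →ₗ[ℝ] ℝ) : R4 →ₗ[ℝ] ℝ) : R4 → ℝ) := by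
    funext v
    rw [ricci0_eq, h.ricci_imN hy hF hX]
    simp
    ring
  refine h.ext_metric hy fun w ↦ ?_
  rw [ricci0Vec, e, hE.metric_sharp (h.symm y hy)]
  simp

/-- When s = 0 the Hermitian matrix of Ric is trace-free, so its square is a scalar. If that scalar
is nonzero, wedging with ρ is injective on 1-forms, and both components of ∇J vanish. -/
theorem ricci_eq_zero_or (hF : ∀ y ∈ U, ∀ u v,
      curvEnd (lc G) u v y * J y = J y * curvEnd (lc G) u v y)
    (hs : (ofFields G J).scal y = 0) : (ofFields G J).ricci y = 0 ∨
      ((ofFields G J).lee y = 0 ∧ (ofFields G J).nij y = 0) := by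
  obtain ⟨E, hE, -⟩ := h.exists_isAdaptedFrame_smul hy (a := basisVec 0) (by simp [basisVec])
  have hsc := h.scal_frame hy (hF y hy) hE
  rw [hs] at hsc
  have key : ∀ f : R4 → ℝ, (∀ u v w, (ofFields G J).rhoStar y u v * f w
      + (ofFields G J).rhoStar y v w * f u + (ofFields G J).rhoStar y w u * f v = 0) →
      ((ofFields G J).ricci y (E 0) (E 0) ^ 2 + (ofFields G J).ricci y (E 0) (E 2) ^ 2
        + (ofFields G J).ricci y (E 0) (E 3) ^ 2)
        * (f (E 0) ^ 2 + f (E 1) ^ 2 + f (E 2) ^ 2 + f (E 3) ^ 2) = 0 := fun f hf ↦ by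
    obtain ⟨r1, r2, r3, r4⟩ := h.ricci_relations hy hF hE hf
    have hβ : (ofFields G J).ricci y (E 2) (E 2) = -(ofFields G J).ricci y (E 0) (E 0) := by
      linarith
    rw [hβ] at r3 r4
    generalize (ofFields G J).ricci y (E 0) (E 0) = α at *
    generalize (ofFields G J).ricci y (E 0) (E 2) = γ at *
    generalize (ofFields G J).ricci y (E 0) (E 3) = δ at *
    -- The left side is the sum of the squares of the four relations; the cross terms cancel once β
    -- = -α.
    linear_combination (α * f (E 2) - γ * f (E 0) + δ * f (E 1)) * r1
      + (α * f (E 3) - δ * f (E 0) - γ * f (E 1)) * r2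
      + (-α * f (E 0) - δ * f (E 3) - γ * f (E 2)) * r3
      + (-α * f (E 1) - γ * f (E 3) + δ * f (E 2)) * r4
  have kRe := key _ fun u v w ↦ (h.rhoStar_wedge_nablaJ hy hF hE u v w).1
  have kIm := key _ fun u v w ↦ (h.rhoStar_wedge_nablaJ hy hF hE u v w).2
  by_cases hz : (ofFields G J).ricci y (E 0) (E 0) ^ 2 + (ofFields G J).ricci y (E 0) (E 2) ^ 2
        + (ofFields G J).ricci y (E 0) (E 3) ^ 2 = 0
  · left
    obtain ⟨z0, z2, z3, -⟩ := eq_zero_of_sum_four_sq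
      (a := (ofFields G J).ricci y (E 0) (E 0)) (b := (ofFields G J).ricci y (E 0) (E 2))
      (c := (ofFields G J).ricci y (E 0) (E 3)) (d := 0) (by linarith)
    have z22 : (ofFields G J).ricci y (E 2) (E 2) = 0 := by linarith
    funext u v
    rw [h.ricci_frame hy (hF y hy) hE, z0, z2, z3, z22]
    simp
  · right
    have hzero : ∀ f : R4 → ℝ, f (E 0) ^ 2 + f (E 1) ^ 2 + f (E 2) ^ 2 + f (E 3) ^ 2 = 0 →
        ∀ k, f (E k) = 0 := fun f hf k ↦ by
      obtain ⟨f0, f1, f2, f3⟩ := eq_zero_of_sum_four_sq hf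
      fin_cases k <;> assumption
    have hm := hzero _ ((mul_eq_zero.1 kRe).resolve_left hz)
    have hn := hzero _ ((mul_eq_zero.1 kIm).resolve_left hz)
    have hK : ∀ u, nablaJ G J u y = 0 := fun u ↦ h.nablaJ_eq_zero hy hE u
      (by rw [nablaJRe_eq_sum hE.isFrame]; simp [hm])
      (by rw [nablaJIm_eq_sum hE.isFrame]; simp [hn])
    constructor
    · funext v
      simp [h.lee_eq hy, hK]
    · funext u v
      simp [h.nij_eq hy, hK]

theorem rhoStar_antisymm (u v : R4) :
    (ofFields G J).rhoStar y u v = -(ofFields G J).rhoStar y v u := by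
  obtain ⟨E, hE⟩ := h.exists_isFrame hy
  rw [h.rhoStar_eq_sum hy hE, h.rhoStar_eq_sum hy hE, curvEnd_antisymm u v]
  simp only [neg_apply, map_neg, Finset.sum_neg_distrib]
  ring

/-- `ρ*` and `Φ` are proportional. -/
theorem Phi_mul_rhoStar (hF : ∀ y ∈ U, ∀ u v,
      curvEnd (lc G) u v y * J y = J y * curvEnd (lc G) u v y) (u v w z : R4) :
    (ofFields G J).Phi y u v * (ofFields G J).rhoStar y w z
      = (ofFields G J).Phi y w z * (ofFields G J).rhoStar y u v := by
  obtain ⟨E, hE, -⟩ := h.exists_isAdaptedFrame_smul hy (a := basisVec 0) (by simp [basisVec])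
  rw [h.Phi_frame hy hE, h.Phi_frame hy hE]
  exact proportional_of_wedge_eq_zero (h.rhoStar_antisymm hy)
    (fun u v w ↦ (h.rhoStar_wedge_nablaJ hy hF hE u v w).1)
    (fun u v w ↦ (h.rhoStar_wedge_nablaJ hy hF hE u v w).2) u v w z

theorem exists_rho_Phi_dependent (hF : ∀ y ∈ U, ∀ u v,
      curvEnd (lc G) u v y * J y = J y * curvEnd (lc G) u v y) :
    ∃ a b : ℝ, (a ≠ 0 ∨ b ≠ 0) ∧ a • (ofFields G J).rho y + b • (ofFields G J).Phi y = 0 := by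
  by_cases hρ : (ofFields G J).rho y = 0
  · exact ⟨1, 0, Or.inl one_ne_zero, by simp [hρ]⟩
  · obtain ⟨w, z, hwz⟩ : ∃ w z, (ofFields G J).rho y w z ≠ 0 := by
      by_contra! hcon
      exact hρ (funext fun w ↦ funext fun z ↦ hcon w z)
    -- Evaluating the proportionality of the two forms at a pair where ρ does not vanish provides
    -- the coefficients.
    refine ⟨(ofFields G J).Phi y w z, -(ofFields G J).rho y w z, Or.inr (neg_ne_zero.2 hwz), ?_⟩
    funext u v
    have := h.Phi_mul_rhoStar hy hF u v w z
    rw [h.rhoStar_eq_rho hy (hF y hy), h.rhoStar_eq_rho hy (hF y hy)] at this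
    simp only [Pi.add_apply, Pi.smul_apply, smul_eq_mul, Pi.zero_apply]
    linarith

theorem wedge_rhoStar_Phi (hF : ∀ y ∈ U, ∀ u v,
      curvEnd (lc G) u v y * J y = J y * curvEnd (lc G) u v y) (u v w z : R4) :
    wedge ((ofFields G J).rhoStar y) ((ofFields G J).Phi y) u v w z = 0 := by
  obtain ⟨E, hE, -⟩ := h.exists_isAdaptedFrame_smul hy (a := basisVec 0) (by simp [basisVec])
  rw [show (ofFields G J).Phi y = _ from funext fun u ↦ funext fun v ↦ h.Phi_frame hy hE u v]
  exact wedge_wedge_eq_zero (h.rhoStar_antisymm hy)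
    (fun u v w ↦ (h.rhoStar_wedge_nablaJ hy hF hE u v w).1) u v w z

/-! ### Points where the Nijenhuis tensor does not vanish -/

/-- Where `N ≠ 0`, there is an adapted frame whose first two vectors span the image of `N`. -/
theorem exists_isAdaptedFrame_imN (hN : (ofFields G J).nij y ≠ 0) :
    ∃ E, IsAdaptedFrame (G y) (J y) E ∧
      (ofFields G J).imN y = Submodule.span ℝ {E 0, E 1} := by
  obtain ⟨E, hE, -⟩ := h.exists_isAdaptedFrame_smul hy (a := basisVec 0) (by simp [basisVec])
  have hν : (ofFields G J).nij y (E 0) (E 2) ≠ 0 := fun h0 ↦ hN <| by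
    funext u v
    rw [h.nij_frame hy hE, h0]
    simp
  obtain ⟨E', hE', r, hr, hE0⟩ := h.exists_isAdaptedFrame_smul hy hν
  refine ⟨E', hE', le_antisymm ?_ ?_⟩
  · rw [imN, Submodule.span_le]
    rintro _ ⟨u, v, rfl⟩
    have e0 : (ofFields G J).nij y (E 0) (E 2) = r⁻¹ • E' 0 := by
      rw [hE0, smul_smul, inv_mul_cancel₀ hr, one_smul]
    have m0 : (ofFields G J).nij y (E 0) (E 2) ∈ Submodule.span ℝ {E' 0, E' 1} := by
      rw [e0]
      exact Submodule.smul_mem _ _ (Submodule.subset_span (by simp))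
    have m1 : J y ((ofFields G J).nij y (E 0) (E 2)) ∈ Submodule.span ℝ {E' 0, E' 1} := by
      rw [e0, map_smul, hE'.J_zero]
      exact Submodule.smul_mem _ _ (Submodule.subset_span (by simp))
    rw [SetLike.mem_coe, h.nij_frame hy hE]
    exact Submodule.sub_mem _ (Submodule.smul_mem _ _ m0) (Submodule.smul_mem _ _ m1)
  · rw [Submodule.span_le]
    have m0 : (ofFields G J).nij y (E 0) (E 2) ∈ (ofFields G J).imN y :=
      Submodule.subset_span ⟨_, _, rfl⟩
    have m1 : J y ((ofFields G J).nij y (E 0) (E 2)) ∈ (ofFields G J).imN y := by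
      have := h.nij_J_left hy (E 0) (E 2)
      rw [← neg_neg (J y _), ← this]
      exact Submodule.neg_mem _ (Submodule.subset_span ⟨_, _, rfl⟩)
    rintro _ (rfl | rfl)
    · rw [hE0]
      exact Submodule.smul_mem _ _ m0
    · rw [← hE'.J_zero, hE0, map_smul]
      exact Submodule.smul_mem _ _ m1

omit h hy in
theorem proj_span_pair (hE : IsFrame (G y) E) (u : R4) :
    (ofFields G J).proj y (Submodule.span ℝ {E 0, E 1}) u
      = G y u (E 0) • E 0 + G y u (E 1) • E 1 := by
  have o : ∀ i j, G y (E i) (E j) = if i = j then (1 : ℝ) else 0 := hE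
  have hex : ∃ a, a ∈ Submodule.span ℝ {E 0, E 1} ∧
      ∀ w ∈ Submodule.span ℝ {E 0, E 1}, G y (u - a) w = 0 := by
    refine ⟨G y u (E 0) • E 0 + G y u (E 1) • E 1, Submodule.mem_span_pair.2 ⟨_, _, rfl⟩, ?_⟩
    intro w hw
    obtain ⟨a, b, rfl⟩ := Submodule.mem_span_pair.1 hw
    simp [o]
    ring
  -- The chosen vector satisfies the defining conditions because some vector does; testing against
  -- e₀ and e₁ then pins down its coefficients.
  have hsp := Classical.epsilon_spec hex
  have hp : (ofFields G J).proj y (Submodule.span ℝ {E 0, E 1}) u = Classical.epsilon fun a ↦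
      a ∈ Submodule.span ℝ {E 0, E 1} ∧ ∀ w ∈ Submodule.span ℝ {E 0, E 1}, G y (u - a) w = 0 := rfl
  rw [← hp] at hsp
  obtain ⟨⟨a, b, hab⟩, h2⟩ := hsp.imp_left Submodule.mem_span_pair.1
  rw [← hab] at h2 ⊢
  have e0 := h2 (E 0) (Submodule.subset_span (by simp))
  have e1 := h2 (E 1) (Submodule.subset_span (by simp))
  simp [o] at e0 e1
  rw [show G y u (E 0) = a by linarith, show G y u (E 1) = b by linarith]

omit h hy in
theorem omegaOn_span_pair (hE : IsAdaptedFrame (G y) (J y) E) (u v : R4) :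
    (ofFields G J).omegaOn y (Submodule.span ℝ {E 0, E 1}) u v
      = G y u (E 0) * G y v (E 1) - G y u (E 1) * G y v (E 0) := by
  have o : ∀ i j, G y (E i) (E j) = if i = j then (1 : ℝ) else 0 := hE.isFrame
  have ho : ∀ a b, (ofFields G J).omega y a b = G y (J y a) b := fun _ _ ↦ rfl
  rw [omegaOn, proj_span_pair hE.isFrame, proj_span_pair hE.isFrame, ho]
  simp [hE.J_zero, hE.J_one, o]
  ring

/-- In a frame with e₀, e₁ spanning Im N, Ric is s/2 on this plane, and its trace forces Ric to
vanish on the complement. As s ≠ 0, the wedge conditions make m and n vanish on e₂, e₃, so Φ is a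
multiple of e⁰ ∧ e¹. The multiple is then compared with |θ|², |N|² and δθ. -/
theorem rho_Phi_eq_omegaOn (hF : ∀ y ∈ U, ∀ u v,
      curvEnd (lc G) u v y * J y = J y * curvEnd (lc G) u v y)
    (hs : (ofFields G J).scal y ≠ 0) (hN : (ofFields G J).nij y ≠ 0) :
    (ofFields G J).rho y =
        ((ofFields G J).scal y / 2) • (ofFields G J).omegaOn y ((ofFields G J).imN y) ∧
      (ofFields G J).Phi y = ((1 / 4) * ((ofFields G J).inner1 y ((ofFields G J).lee y)
        ((ofFields G J).lee y) - (1 / 4) * (ofFields G J).nijNormSq y)) •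
          (ofFields G J).omegaOn y ((ofFields G J).imN y) ∧
      (ofFields G J).Phi y = (-(1 / 2) * (ofFields G J).delta1 y (ofFields G J).lee) •
          (ofFields G J).omegaOn y ((ofFields G J).imN y) := by
  obtain ⟨E, hE, himN⟩ := h.exists_isAdaptedFrame_imN hy hN
  have o : ∀ i j, G y (E i) (E j) = if i = j then (1 : ℝ) else 0 := hE.isFrame
  have hR := h.ricci_imN hy hF (X := E 0) (by rw [himN]; exact Submodule.subset_span (by simp))
  have r00 := hR (E 0)
  have r02 := hR (E 2)
  have r03 := hR (E 3)
  simp [o] at r00 r02 r03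
  have r22 : (ofFields G J).ricci y (E 2) (E 2) = 0 := by
    have := h.scal_frame hy (hF y hy) hE
    linarith
  obtain ⟨m1, m2, -, -⟩ := h.ricci_relations hy hF hE
    fun u v w ↦ (h.rhoStar_wedge_nablaJ hy hF hE u v w).1
  obtain ⟨n1, n2, -, -⟩ := h.ricci_relations hy hF hE
    fun u v w ↦ (h.rhoStar_wedge_nablaJ hy hF hE u v w).2
  -- Only Ric(e₀, e₀) = s/2 ≠ 0 survives in these relations, leaving m(e₂) = m(e₃) = n(e₂) = n(e₃) =
  -- 0.
  simp [r00, r02, r03, hs] at m1 m2 n1 n2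
  obtain ⟨t0, t1, t2, t3⟩ := h.lee_frame hy hE
  have hΦ : ∀ u v, (ofFields G J).Phi y u v =
      (nablaJRe G J E y (E 0) * nablaJIm G J E y (E 1)
        - nablaJRe G J E y (E 1) * nablaJIm G J E y (E 0)) *
      (G y u (E 0) * G y v (E 1) - G y u (E 1) * G y v (E 0)) := fun u v ↦ by
    rw [h.Phi_frame hy hE, nablaJRe_eq_sum hE.isFrame u, nablaJRe_eq_sum hE.isFrame v,
      nablaJIm_eq_sum hE.isFrame u, nablaJIm_eq_sum hE.isFrame v]
    simp only [Fin.sum_univ_four, m1, m2, n1, n2]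
    ring
  rw [himN]
  refine ⟨?_, ?_, ?_⟩
  · funext u v
    rw [h.rho_eq hy (hF y hy), h.ricci_frame hy (hF y hy) hE, r00, r02, r03, r22, Pi.smul_apply,
      Pi.smul_apply, omegaOn_span_pair hE, h.J_skew hy, h.J_skew hy, hE.J_zero, hE.J_one]
    simp only [map_neg, smul_eq_mul]
    ring
  · have hl : (ofFields G J).inner1 y ((ofFields G J).lee y) ((ofFields G J).lee y)
        = ∑ k, (ofFields G J).lee y (E k) * (ofFields G J).lee y (E k) := by
      obtain ⟨θ, hθ⟩ := h.exists_lee_linear hy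
      rw [inner1, hE.isFrame.tr_eq]
      constructor <;> intros <;> simp only [hθ, map_add, map_smul, smul_eq_mul] <;> ring
    have hnn : (ofFields G J).nijNormSq y =
        4 * ((nablaJRe G J E y (E 1) + nablaJIm G J E y (E 0)) ^ 2
          + (nablaJRe G J E y (E 0) - nablaJIm G J E y (E 1)) ^ 2) := by
      rw [h.nijNormSq_frame hy hE, h.nij_frame_apply hy hE]
      simp [m1, m2, n1, n2, o]
      ring
    funext u v
    rw [hΦ, hl, hnn, Pi.smul_apply, Pi.smul_apply, omegaOn_span_pair hE]
    simp only [Fin.sum_univ_four, t0, t1, t2, t3, m1, m2, n1, n2, smul_eq_mul]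
    ring
  · funext u v
    rw [hΦ, h.delta1_lee_frame hy hF hE, Pi.smul_apply, Pi.smul_apply,
      omegaOn_span_pair hE]
    simp only [m1, m2, n1, n2, smul_eq_mul]
    ring

/-- ρ and ρ* agree on a whole neighbourhood, so their derivatives agree. -/
theorem extd_rho (hF : ∀ y ∈ U, ∀ u v,
      curvEnd (lc G) u v y * J y = J y * curvEnd (lc G) u v y) (u v w : R4) :
    extd (ofFields G J).rho y u v w = 0 := by
  have hp : ∀ u v w, pd w (fun z ↦ (ofFields G J).rho z u v) y
      = pd w (fun z ↦ (ofFields G J).rhoStar z u v) y := fun u v w ↦ by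
    refine pd_congr ?_ w
    filter_upwards [h.eventually_mem hy] with z hz using (h.rhoStar_eq_rho hz (hF z hz) u v).symm
  have := h.extd_rhoStar hy hF u v w
  simp only [extd, hp] at this ⊢
  exact this

end IsAlmostHermitianOn
end

/-! ### The theorem, read in an arbitrary chart of the maximal atlas. -/

theorem proposition5p2 {M : Type*} [TopologicalSpace M] [ChartedSpace R4 M]
    [IsManifold (𝓡 4) ∞ M] (A : AlmostHermitian M) (hA : A.IsAH1)
    (e : OpenPartialHomeomorph M R4) (he : e ∈ IsManifold.maximalAtlas (𝓡 4) ∞ M)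
    (c : Coord) (hc : c = A.inChart e) (x : R4) (hx : x ∈ e.target) :
    -- `θ` and `Jθ` are eigenforms of `Ric₀`
    (c.ricci0Form x (c.lee x) = (-(c.scal x / 4)) • c.lee x ∧
      c.ricci0Form x (c.Jform x (c.lee x)) = (-(c.scal x / 4)) • c.Jform x (c.lee x)) ∧
    -- orthogonality of `Span(θ, Jθ)` and `Im N` where `s ≠ 0`
    (c.scal x ≠ 0 →
      ∀ X ∈ Submodule.span ℝ {c.sharp x (c.lee x), c.sharp x (c.Jform x (c.lee x))},
        ∀ Y ∈ c.imN x, c.g x X Y = 0) ∧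
    -- `Ric₀` on `Im N`
    (∀ X ∈ c.imN x, c.ricci0Vec x X = (c.scal x / 4) • X) ∧
    -- points where `s = 0`
    (c.scal x = 0 → c.ricci x = 0 ∨ (c.lee x = 0 ∧ c.nij x = 0)) ∧
    -- `ρ` and `Φ` are closed, pointwise collinear, and explicit at generic points
    ((∀ u v w, Coord.extd c.rho x u v w = 0) ∧ (∀ u v w, Coord.extd c.Phi x u v w = 0) ∧
      (∃ a b : ℝ, (a ≠ 0 ∨ b ≠ 0) ∧ a • c.rho x + b • c.Phi x = 0) ∧
      (c.scal x ≠ 0 → c.lee x ≠ 0 → c.nij x ≠ 0 →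
        c.rho x = (c.scal x / 2) • c.omegaOn x (c.imN x) ∧
        c.Phi x = ((1 / 4) * (c.inner1 x (c.lee x) (c.lee x) - (1 / 4) * c.nijNormSq x)) •
          c.omegaOn x (c.imN x) ∧
        c.Phi x = (-(1 / 2) * c.delta1 x c.lee) • c.omegaOn x (c.imN x))) ∧
    -- `ρ* ∧ Φ = 0`
    (∀ u v w z, Coord.wedge (c.rhoStar x) (c.Phi x) u v w z = 0) := by
  have h := A.isAlmostHermitianOn_chart he
  have hA' : ∀ y ∈ e.target, ∀ u v w z, c.curv y u v w z = c.curv y u v (c.J y w) (c.J y z) :=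
    fun y hy ↦ hc ▸ hA e he y hy
  rw [A.inChart_eq] at hc
  subst hc
  -- The commutation of curvature and J is needed on the whole chart domain, not only at `x`, since
  -- it gets differentiated.
  have hF := fun y hy ↦ h.curvEnd_comm_J (y := y) hy hA'
  exact ⟨⟨h.ricci0Form_lee hx hF, h.ricci0Form_Jform_lee hx hF⟩,
    fun hs X hX Y hY ↦ h.metric_lee_imN hx hF hs hX hY,
    fun X hX ↦ h.ricci0Vec_imN hx hF hX,
    h.ricci_eq_zero_or hx hF,
    ⟨h.extd_rho hx hF, h.extd_Phi hx hF, h.exists_rho_Phi_dependent hx hF,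
      fun hs _ hN ↦ h.rho_Phi_eq_omegaOn hx hF hs hN⟩,
    h.wedge_rhoStar_Phi hx hF⟩
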